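/- Let $\mathbb X$ be a standard Borel space and let $\mathbb Y$, $\mathbb U$ be finite sets, $\mathbb U\neq\emptyset$. Consider a partially observed controlled Markov process with transition kernel $\mathcal T(dx'\mid x,u)$ from $\mathbb X\times\mathbb U$ to $\mathbb X$, observation channel $Q(y\mid x)$ from $\mathbb X$ to $\mathbb Y$, bounded measurable cost $c:\mathbb X\times\mathbb U\to\mathbb R$, $\|c\|_\infty=\sup|c|$, and discount factor $\beta\in(0,1)$. An admissible policy $\gamma$ chooses $U_n=\gamma_n(Y_0,\dots,Y_n,U_0,\dots,U_{n-1})$. Write $P^\gamma_z$, $E^\gamma_z$ for the law and the expectation when $X_0\sim z$, and $P^z(X_N\in\cdot\mid y_{[0,N]},u_{[0,N-1]})$ for the conditional law of $X_N$ given $Y_{[0,N]}=y_{[0,N]}$ when $X_0\sim z$ and the actions $u_{[0,N-1]}$ are applied. Put $\|\mu-\nu\|_{TV}=2\sup_B|\mu(B)-\nu(B)|$. Nonnegative finite measures $\mu,\nu$ are comparable if $a\nu\le\mu\le b\nu$ for some constants $0<a\le b$; the Hilbert metric is $h(\mu,\nu)=\log\frac{\sup_{A:\nu(A)>0}\mu(A)/\nu(A)}{\inf_{A:\nu(A)>0}\mu(A)/\nu(A)}$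 if $\mu,\nu$ are comparable (and nonzero), $h(0,0)=0$, and $h(\mu,\nu)=\infty$ otherwise. Assume that there is $\epsilon>0$ with $Q(y\mid x)\ge\epsilon$ for all $x\in\mathbb X$, $y\in\mathbb Y$, and that for every $u\in\mathbb U$ there are $\epsilon_u\in(0,1]$ and a nonnegative measure $\lambda_u$ on $\mathbb X$ with $\epsilon_u\lambda_u(A)\le\mathcal T(A\mid x,u)\le\epsilon_u^{-1}\lambda_u(A)$ for all $x\in\mathbb X$ and all Borel $A$. Fix a reference probability measure $z^*$ on $\mathbb X$ and set $$r=\sup_{u\in\mathbb U}\frac{1-\epsilon_u^2\epsilon}{1+\epsilon_u^2\epsilon},\qquad K=\frac{2}{\log 3}\,\sup_{z,\,y_0,y_1,u_0} h\bigl(P^{z}(X_1\in\cdot\mid y_0,y_1,u_0),\,P^{z^*}(X_1\in\cdot\mid y_0,y_1,u_0)\bigr),$$ where $z$ ranges over all probability measures on $\mathbb X$. Then $0\le r<1$, $K<\infty$, and the following hold for every $N\ge 1$ and every initial law $z_0^-$ of $X_0$. (1) For every $t\ge 0$, $$L_t^N:=\sup_{\hat\gamma\in\hat\Gamma}E^{\hat\gamma}_{z_0^-}\Bigl[\bigl\|P^{z_t^-}(X_{t+N}\in\cdot\mid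 Y_{[t,t+N]},U_{[t,t+N-1]})-P^{z^*}(X_{t+N}\in\cdot\mid Y_{[t,t+N]},U_{[t,t+N-1]})\bigr\|_{TV}\Bigr]\le r^{N-1}K,$$ where $z_t^-$ is the conditional law of $X_t$ given $Y_{[0,t-1]},U_{[0,t-1]}$ and $\hat\Gamma$ is the set of admissible policies whose action at each time $n\ge N$ is a function of $n$ and of $(z_{n-N}^-,Y_{[n-N,n]},U_{[n-N,n-1]})$. (2) For a window $I=(y_{[0,N]},u_{[0,N-1]})$ and a policy $\gamma$ let $J_\beta((z,I),\gamma)$ be the conditional expectation of $\sum_{t\ge0}\beta^t c(X_{N+t},U_{N+t})$ given $Y_{[0,N]}=y_{[0,N]}$, when $X_0\sim z$, the actions $u_{[0,N-1]}$ are applied before time $N$ and $\gamma$ is followed from time $N$ on, and let $J^*_\beta(z,I)=\inf_\gamma J_\beta((z,I),\gamma)$ over all admissible policies. Let $\phi^N:\mathbb Y^{N+1}\times\mathbb U^N\to\mathbb U$ be any optimal policy of the approximate finite model, that is, a selector of minimisers in $$J^N_\beta(I)=\min_{u\in\mathbb U}\Bigl(\int c(x,u)\,P^{z^*}(X_N\in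 dx\mid I)+\beta\sum_{I'}J^N_\beta(I')\,\hat\eta^N(I'\mid I,u)\Bigr),$$ where $\hat\eta^N(I'\mid I,u)$ is the probability, under $X_0\sim z^*$ and given $I$ and $U_N=u$, that $I'=(Y_{[1,N+1]},U_{[1,N]})$. Let $\tilde\phi^N$ be the policy that applies $\phi^N$ at every time $n\ge N$ to the current window $(Y_{[n-N,n]},U_{[n-N,n-1]})$. If any admissible policy $\hat\gamma$ produces the initial window $I_0^N=(Y_{[0,N]},U_{[0,N-1]})$, and $\hat z_0=(z_0^-,I_0^N)$, then, almost surely, $$E^{\hat\gamma}_{z_0^-}\Bigl[\bigl|J_\beta(\hat z_0,\tilde\phi^N)-J^*_\beta(\hat z_0)\bigr|\,\Big|\,I_0^N\Bigr]\le\frac{2\|c\|_\infty}{(1-\beta)^2}\,r^{N-1}K,$$ and the same bound holds for the unconditional expectation $E^{\hat\gamma}_{z_0^-}\bigl[|J_\beta(\hat z_0,\tilde\phi^N)-J^*_\beta(\hat z_0)|\bigr]$. -/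

import Mathlib

open MeasureTheory ProbabilityTheory
open scoped ENNReal

namespace FiniteWindow

/-! ### Measures: total variation, mixing kernels, the Hilbert metric -/

section Measures

variable {X : Type*} [MeasurableSpace X]

/-- Total variation distance of two probability measures, with the normalisation
`‖μ - ν‖_TV = 2 * sup_B |μ B - ν B|`. -/
noncomputable def tvDist (μ ν : Measure X) : ℝ :=
  2 * ⨆ B : {B : Set X // MeasurableSet B}, |μ.real B - ν.real B|

/-- `K` is a mixing kernel with mixing constant `e`. -/
def IsMixing (K : Kernel X X) (e : ℝ) : Prop :=
  0 < e ∧ e ≤ 1 ∧ ∃ lam : Measure X, ∀ x : X, ∀ A : Set X, MeasurableSet A →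
    ENNReal.ofReal e * lam A ≤ K x A ∧ K x A ≤ ENNReal.ofReal (1 / e) * lam A

/-- Comparability of two nonnegative measures. -/
def Comparable (μ ν : Measure X) : Prop :=
  ∃ a b : ℝ, 0 < a ∧ a ≤ b ∧ ∀ A : Set X, MeasurableSet A →
    ENNReal.ofReal a * ν A ≤ μ A ∧ μ A ≤ ENNReal.ofReal b * ν A

/-- The supremum of `μ A / ν A` over measurable `A` with `ν A > 0`. -/
noncomputable def supRatio (μ ν : Measure X) : ℝ≥0∞ :=
  ⨆ A : {A : Set X // MeasurableSet A ∧ 0 < ν A}, μ A / ν A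

/-- The infimum of `μ A / ν A` over measurable `A` with `ν A > 0`. -/
noncomputable def infRatio (μ ν : Measure X) : ℝ≥0∞ :=
  ⨅ A : {A : Set X // MeasurableSet A ∧ 0 < ν A}, μ A / ν A

open Classical in
/-- The Hilbert (projective) metric on nonnegative finite measures, with values in `[0, ∞]`. -/
noncomputable def hilbertMetric (μ ν : Measure X) : ℝ≥0∞ :=
  if μ = 0 ∧ ν = 0 then 0
  else if Comparable μ ν then
    ENNReal.ofReal (Real.log ((supRatio μ ν).toReal / (infRatio μ ν).toReal))
  else ⊤

end Measures

/-! ### Policies -/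

section Policies

variable {Y U : Type*}

/-- An admissible (deterministic, history dependent) policy: the action at time `n` is a function
of the observations `y₀, …, yₙ` and the actions `u₀, …, uₙ₋₁`. -/
abbrev Policy (Y U : Type*) := ∀ n : ℕ, (Fin (n + 1) → Y) → (Fin n → U) → U

/-- The action which a policy takes at time `n` when the observations are `y₀, …, yₙ`:
`Uₙ = γₙ(y₀, …, yₙ, U₀, …, Uₙ₋₁)`. -/
def Policy.act (γ : Policy Y U) : (n : ℕ) → (Fin (n + 1) → Y) → U
  | n, y => γ n y (fun i : Fin n =>
      Policy.act γ i.1 (fun j : Fin (i.1 + 1) => y ⟨j.1, by have := i.2; have := j.2; omega⟩))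
  termination_by n => n
  decreasing_by exact i.2

/-- Apply the actions `u₀, …, u_{N-1}` first, then continue with `γ`. -/
def steer {N : ℕ} (u : Fin N → U) (γ : Policy Y U) : Policy Y U :=
  fun n y v => if h : n < N then u ⟨n, h⟩ else γ n y v

/-- A window `(y₀, …, y_N ; u₀, …, u_{N-1})` of `N + 1` observations and `N` actions. -/
abbrev Window (Y U : Type*) (N : ℕ) := (Fin (N + 1) → Y) × (Fin N → U)

/-- Drop the oldest observation and action of a window, append the action `u` and the
observation `y`. -/
def Window.shift {N : ℕ} (w : Window Y U N) (u : U) (y : Y) : Window Y U N :=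
  (fun i : Fin (N + 1) => (Fin.snoc w.1 y : Fin (N + 2) → Y) i.succ,
   fun i : Fin N => (Fin.snoc w.2 u : Fin (N + 1) → U) i.succ)

variable [Nonempty U]

/-- An arbitrary policy; it only serves to fill in actions that have no influence. -/
noncomputable def defaultPolicy (Y U : Type*) [Nonempty U] : Policy Y U :=
  fun _ _ _ => Classical.arbitrary U

/-- The finite window policy which, from time `N` on, applies `φ` to the most recent window
(and anything before time `N`). -/
noncomputable def windowPolicy {N : ℕ} (φ : Window Y U N → U) : Policy Y U :=
  fun n y v =>
    if h : N ≤ n then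
      φ (fun i : Fin (N + 1) => y ⟨n - N + i.1, by have := i.2; omega⟩,
         fun i : Fin N => v ⟨n - N + i.1, by have := i.2; omega⟩)
    else Classical.arbitrary U

end Policies

/-! ### The partially observed controlled Markov process -/

section Model

variable {X Y U : Type*} [MeasurableSpace X]
  [Fintype Y] [MeasurableSpace Y] [MeasurableSingletonClass Y]
  [Fintype U] [MeasurableSpace U] [MeasurableSingletonClass U]

/-- `(xₙ, uₙ)` as a function of `(x₀, y₀), …, (xₙ, yₙ)` when the policy `γ` is used. -/
def lastStateAction (γ : Policy Y U) (n : ℕ) (h : Finset.Iic n → X × Y) : X × U :=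
  ((h ⟨n, Finset.mem_Iic.2 le_rfl⟩).1,
    γ.act n (fun i : Fin (n + 1) => (h ⟨i.1, Finset.mem_Iic.2 (Nat.lt_succ_iff.1 i.2)⟩).2))

theorem measurable_lastStateAction (γ : Policy Y U) (n : ℕ) :
    Measurable (lastStateAction (X := X) γ n) := by
  refine Measurable.prodMk (by fun_prop) ?_
  exact (Measurable.of_discrete (f := γ.act n)).comp (by fun_prop)

/-- The conditional law of `(Xₙ₊₁, Yₙ₊₁)` given the past: `Q(dy | x') T(dx' | xₙ, uₙ)`. -/
noncomputable def stepKernel (T : Kernel (X × U) X) (Q : Kernel X Y) (γ : Policy Y U) (n : ℕ) :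
    Kernel (Finset.Iic n → X × Y) (X × Y) :=
  (T ⊗ₖ Kernel.prodMkLeft (X × U) Q).comap (lastStateAction γ n) (measurable_lastStateAction γ n)

instance (T : Kernel (X × U) X) [IsMarkovKernel T] (Q : Kernel X Y) [IsMarkovKernel Q]
    (γ : Policy Y U) (n : ℕ) : IsMarkovKernel (stepKernel T Q γ n) := by
  unfold stepKernel; infer_instance

variable (T : Kernel (X × U) X) [IsMarkovKernel T] (Q : Kernel X Y) [IsMarkovKernel Q]

/-- The law `P_μ^γ` of the trajectory `(Xₙ, Yₙ)ₙ`, when `X₀` has law `μ` and `γ` is used. -/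
noncomputable def pathMeasure (γ : Policy Y U) (μ : Measure X) : Measure (ℕ → X × Y) :=
  Kernel.trajMeasure (X := fun _ : ℕ => X × Y) (μ ⊗ₘ Q) (stepKernel T Q γ)

/-- The state `Xₙ`. -/
def stateAt (n : ℕ) (ω : ℕ → X × Y) : X := (ω n).1

/-- The observation `Yₙ`. -/
def obsAt (n : ℕ) (ω : ℕ → X × Y) : Y := (ω n).2

/-- The action `Uₙ` under the policy `γ`. -/
def actionAt (γ : Policy Y U) (n : ℕ) (ω : ℕ → X × Y) : U :=
  γ.act n (fun i : Fin (n + 1) => obsAt i.1 ω)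

/-- The window `(Y_[t,t+N], U_[t,t+N-1])` on a trajectory. -/
def windowAt (γ : Policy Y U) (N t : ℕ) (ω : ℕ → X × Y) : Window Y U N :=
  (fun i => obsAt (t + i.1) ω, fun i => actionAt γ (t + i.1) ω)

/-- The event that the first `k` observations are `y₀, …, y_{k-1}`. -/
def obsEvent (X : Type*) {k : ℕ} (y : Fin k → Y) : Set (ℕ → X × Y) :=
  {ω | ∀ i : Fin k, obsAt i.1 ω = y i}

variable [Nonempty U]

/-- The posterior `P^z(X_N ∈ · | y₀, …, y_N, u₀, …, u_{N-1})`: the elementary conditional law of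
`X_N` given the observations, when `X₀` has law `z` and the actions `u₀, …, u_{N-1}` are applied. -/
noncomputable def posterior (z : Measure X) {N : ℕ} (w : Window Y U N) : Measure X :=
  ((pathMeasure T Q (steer w.2 (defaultPolicy Y U)) z)[|obsEvent X w.1]).map (stateAt N)

/-- The predictor `P^z(X_t ∈ · | y₀, …, y_{t-1}, u₀, …, u_{t-1})`. -/
noncomputable def predictor (z : Measure X) {t : ℕ} (y : Fin t → Y) (u : Fin t → U) : Measure X :=
  ((pathMeasure T Q (steer u (defaultPolicy Y U)) z)[|obsEvent X y]).map (stateAt t)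

/-- The predictor `z_t⁻` on a trajectory, when `X₀` has law `z`. -/
noncomputable def predictorAt (γ : Policy Y U) (z : Measure X) (t : ℕ) (ω : ℕ → X × Y) :
    Measure X :=
  predictor T Q z (fun i : Fin t => obsAt i.1 ω) (fun i : Fin t => actionAt γ i.1 ω)

/-! ### The filter stability term -/

/-- The policies which, from time `N` on, are functions of time and of the controlled state
`(z⁻_{n-N}, I_n^N)`, where `n = k + N`. -/
def IsWindowMarkov (z : Measure X) (N : ℕ) (γ : Policy Y U) : Prop :=
  ∃ g : ℕ → Measure X → Window Y U N → U,
    ∀ (k : ℕ) (y : Fin (k + N + 1) → Y) (v : Fin (k + N) → U),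
      γ (k + N) y v =
        g k
          (predictor T Q z
            (fun i : Fin k => y ⟨i.1, by have := i.2; omega⟩)
            (fun i : Fin k => v ⟨i.1, by have := i.2; omega⟩))
          (fun i : Fin (N + 1) => y ⟨k + i.1, by have := i.2; omega⟩,
           fun i : Fin N => v ⟨k + i.1, by have := i.2; omega⟩)

/-- The expected total variation filter stability term `L_t^N`, for the initial law `z` of `X₀`
and the reference predictor `zs`. -/
noncomputable def filterStability (z zs : Measure X) (N t : ℕ) : ℝ :=
  ⨆ γ : {γ : Policy Y U // IsWindowMarkov T Q z N γ},
    ∫ ω, tvDist (posterior T Q (predictorAt T Q γ.1 z t ω) (windowAt γ.1 N t ω))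
        (posterior T Q zs (windowAt γ.1 N t ω)) ∂(pathMeasure T Q γ.1 z)

/-- `sup h(Z₁, Z₁*)`, over all initial laws `z` and all `y₀, y₁, u₀`. -/
noncomputable def supHilbert (zs : Measure X) : ℝ≥0∞ :=
  ⨆ z : ProbabilityMeasure X, ⨆ w : Window Y U 1,
    hilbertMetric (posterior T Q (z : Measure X) w) (posterior T Q zs w)

/-- `K = (2 / log 3) sup h(Z₁, Z₁*)`. -/
noncomputable def stabilityConst (zs : Measure X) : ℝ :=
  2 / Real.log 3 * (supHilbert T Q zs).toReal

/-! ### Costs and the finite window approximation -/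

/-- `J_β(ẑ₀, γ)` for `ẑ₀ = (z, w)`: the expected discounted cost from time `N` on, when `X₀` has
law `z`, the window `w` is observed at times `0, …, N`, and the policy `γ` is used from time `N`. -/
noncomputable def costFrom (c : X × U → ℝ) (β : ℝ) (z : Measure X) {N : ℕ} (w : Window Y U N)
    (γ : Policy Y U) : ℝ :=
  ∫ ω, ∑' t : ℕ, β ^ t * c (stateAt (N + t) ω, actionAt (steer w.2 γ) (N + t) ω)
    ∂((pathMeasure T Q (steer w.2 γ) z)[|obsEvent X w.1])

/-- The optimal cost `J_β*(ẑ₀)` for `ẑ₀ = (z, w)`. -/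
noncomputable def optCostFrom (c : X × U → ℝ) (β : ℝ) (z : Measure X) {N : ℕ}
    (w : Window Y U N) : ℝ :=
  ⨅ γ : Policy Y U, costFrom T Q c β z w γ

/-- The cost `ĉ(z*, w, u)` of the approximate model. -/
noncomputable def approxCost (c : X × U → ℝ) (zs : Measure X) {N : ℕ} (w : Window Y U N)
    (u : U) : ℝ :=
  ∫ x, c (x, u) ∂(posterior T Q zs w)

/-- The transition probability `η̂^N(w' | w, u)` of the approximate model: the probability, with
`X₀` of law `zs`, given the observations of `w` and under the actions of `w` followed by `u`, that
the next window is `w'`. -/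
noncomputable def approxTrans (zs : Measure X) {N : ℕ} (w : Window Y U N) (u : U)
    (w' : Window Y U N) : ℝ :=
  ((pathMeasure T Q (steer (Fin.snoc w.2 u : Fin (N + 1) → U) (defaultPolicy Y U)) zs)[|
    obsEvent X w.1]).real {ω | w.shift u (obsAt (N + 1) ω) = w'}

open Classical in
/-- The right hand side of the optimality equation of the approximate model, before minimisation. -/
noncomputable def approxBellman (c : X × U → ℝ) (β : ℝ) (zs : Measure X) {N : ℕ}
    (J : Window Y U N → ℝ) (w : Window Y U N) (u : U) : ℝ :=
  approxCost T Q c zs w u + β * ∑ w' : Window Y U N, J w' * approxTrans T Q zs w u w'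

/-- `φ` is an optimal policy of the approximate model: it selects minimisers in the optimality
equation of the value function `J`. -/
def IsOptimalWindowPolicy (c : X × U → ℝ) (β : ℝ) (zs : Measure X) {N : ℕ}
    (φ : Window Y U N → U) : Prop :=
  ∃ J : Window Y U N → ℝ,
    (∀ w, J w = ⨅ u : U, approxBellman T Q c β zs J w u) ∧
    ∀ w, approxBellman T Q c β zs J w (φ w) = J w

/-- The performance gap `|J_β(ẑ₀, φ̃) - J_β*(ẑ₀)|` at `ẑ₀ = (z, w)` of the window policy `φ`. -/
noncomputable def perfGap (c : X × U → ℝ) (β : ℝ) (z : Measure X) {N : ℕ}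
    (φ : Window Y U N → U) (w : Window Y U N) : ℝ :=
  |costFrom T Q c β z w (windowPolicy φ) - optCostFrom T Q c β z w|

end Model

end FiniteWindow

set_option linter.unusedSectionVars false

/-! Filter stability comes from Birkhoff's contraction theorem. The Hilbert metric ignores
normalisation, so the filter can be followed as an unnormalised recursion alternating a Bayes
reweighting with a transition kernel. Reweighting multiplies both measures by the same density and
does not expand the metric. A kernel with mixing constant `e` contracts it by `(1 - e ^ 2) / (1 + e
^ 2)` (`HilbertBounded.comp`), which is at most `r` because `ε ≤ 1`. One mixing step already brings
any two initial laws to a finite distance (`supHilbert_lt_top`), and each of the remaining `N - 1`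
steps gains a factor `r`. Total variation is at most the Hilbert distance, and `2 / log 3 ≥ 1`, so
`tvDist_posterior_le` bounds the posterior error by `r ^ (N - 1) * K`, uniformly in the initial law
and the window. Part (1) integrates this pathwise bound.

For part (2), the right hand side of the approximate optimality equation is the integral of one
function of the hidden state, bounded by `‖c‖ / (1 - β)`, against the posterior started from `zs`
(`approxBellman_eq_integral`). In the true process the same function is integrated against the
posterior started from the current predictor. Each step of the true process therefore satisfies the
approximate Bellman relation up to `‖c‖ / (1 - β) * L`, with `L` the stability bound
(`abs_setIntegral_obsEvent_le`). Telescoping the discounted errors divides by another `1 - β`. This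
bounds the cost of every policy from below, and that of the window policy from above, by the
approximate value function; the two errors add up to the factor `2` (`costFrom_bounds`,
`perfGap_le`). The estimate holds for every window, so taking expectations costs nothing. -/

namespace FiniteWindow

/-! ### The scalar inequality behind Birkhoff contraction. -/

section RealInequalities

/-- The logarithmic cross-ratio of two points is contracted by a positive Möbius map. -/
theorem log_moebius_le {k a b P R : ℝ} (hk0 : 0 < k) (hk1 : k ≤ 1) (ha : 0 < a) (hab : a ≤ b)
    (hP : 0 ≤ P) (hR : 0 ≤ R) (hPR : 0 < P + R) :
    Real.log ((b * P + a * k * R) / (P + k * R) / ((b * k * P + a * R) / (k * P + R)))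
      ≤ (1 - k) / (1 + k) * Real.log (b / a) := by
  set s := b / a with hs
  have hs1 : 1 ≤ s := (one_le_div ha).2 hab
  have hpos1 : ∀ x : ℝ, 0 < x → 0 < x * P + k * R := fun x hx => by
    rcases hP.eq_or_lt with h | h
    · have : 0 < R := by linarith
      subst h; simpa using mul_pos hk0 this
    · exact add_pos_of_pos_of_nonneg (mul_pos hx h) (mul_nonneg hk0.le hR)
  have hpos2 : ∀ x : ℝ, 0 < x → 0 < x * k * P + R := fun x hx => by
    rcases hP.eq_or_lt with h | h
    · have : 0 < R := by linarith
      subst h; simpa using this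
    · exact add_pos_of_pos_of_nonneg (mul_pos (mul_pos hx hk0) h) hR
  -- With `s = b / a`, the claim rearranges to `g 1 ≤ g s`.
  set g : ℝ → ℝ := fun x =>
    (1 - k) / (1 + k) * Real.log x - Real.log (x * P + k * R) + Real.log (x * k * P + R) with hg
  have hder : ∀ x : ℝ, 0 < x → HasDerivAt g
      ((1 - k) / (1 + k) * x⁻¹ - P / (x * P + k * R) + k * P / (x * k * P + R)) x := by
    intro x hx
    have h1 : HasDerivAt (fun x : ℝ => x * P + k * R) P x := by
      simpa using ((hasDerivAt_id x).mul_const P).add_const (k * R)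
    have h2 : HasDerivAt (fun x : ℝ => x * k * P + R) (k * P) x := by
      simpa using (((hasDerivAt_id x).mul_const k).mul_const P).add_const R
    exact (((Real.hasDerivAt_log hx.ne').const_mul _).sub (h1.log (hpos1 x hx).ne')).add
      (h2.log (hpos2 x hx).ne')
  have hmono : MonotoneOn g (Set.Ici 1) := by
    apply monotoneOn_of_deriv_nonneg (convex_Ici 1)
    · exact fun x hx => (hder x (lt_of_lt_of_le one_pos hx)).continuousAt.continuousWithinAt
    · intro x hx
      rw [interior_Ici] at hx
      exact (hder x (one_pos.trans hx)).differentiableAt.differentiableWithinAt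
    · intro x hx
      rw [interior_Ici] at hx
      have hx0 : 0 < x := one_pos.trans hx
      rw [(hder x hx0).deriv]
      have p1 := hpos1 x hx0
      have p2 := hpos2 x hx0
      have hk' : 0 < 1 + k := by linarith
      -- The derivative is a perfect square over a positive quantity, vanishing only where `x * P =
      -- R` if `k < 1`: this is what singles out the rate `(1 - k) / (1 + k)`.
      have : (1 - k) / (1 + k) * x⁻¹ - P / (x * P + k * R) + k * P / (x * k * P + R)
          = (1 - k) * k * (x * P - R) ^ 2
            / ((1 + k) * x * ((x * P + k * R) * (x * k * P + R))) := by
        have q1 := p1.ne'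
        have q2 := p2.ne'
        generalize hw : x * k * P + R = w at q2 ⊢
        generalize hv : x * P + k * R = v at q1 ⊢
        field_simp
        rw [← hw, ← hv]
        ring
      rw [this]
      have : 0 ≤ 1 - k := by linarith
      positivity
  have h1 : g 1 ≤ g s := hmono (Set.mem_Ici.2 le_rfl) (Set.mem_Ici.2 hs1) hs1
  have hs0 : 0 < s := one_pos.trans_le hs1
  have hb : b = s * a := by rw [hs]; field_simp
  have e1 : (b * P + a * k * R) / (P + k * R) / ((b * k * P + a * R) / (k * P + R))
      = ((s * P + k * R) * (1 * k * P + R)) / ((1 * P + k * R) * (s * k * P + R)) := by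
    have q1 := (hpos1 1 one_pos).ne'
    have q2 := (hpos2 1 one_pos).ne'
    have q3 := (hpos2 s hs0).ne'
    have q4 : b * k * P + a * R ≠ 0 := by
      rw [hb, show s * a * k * P + a * R = a * (s * k * P + R) by ring]
      exact mul_ne_zero ha.ne' q3
    rw [one_mul] at q1 q2
    rw [div_div_div_eq, one_mul, one_mul, div_eq_div_iff (mul_ne_zero q1 q4) (mul_ne_zero q1 q3),
      hb]
    ring
  rw [e1, Real.log_div (mul_pos (hpos1 s hs0) (hpos2 1 one_pos)).ne'
    (mul_pos (hpos1 1 one_pos) (hpos2 s hs0)).ne',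
    Real.log_mul (hpos1 s hs0).ne' (hpos2 1 one_pos).ne',
    Real.log_mul (hpos1 1 one_pos).ne' (hpos2 s hs0).ne']
  simp only [hg, Real.log_one, mul_zero] at h1
  linarith

end RealInequalities

/-! ### Hilbert metric: invariance, Birkhoff contraction, comparison with explicit constants. -/

section HilbertBound

variable {X : Type*} [MeasurableSpace X]

/-- `μ` and `ν` are comparable with Hilbert distance at most `H`. -/
def HilbertBounded (H : ℝ) (μ ν : Measure X) : Prop :=
  ∃ a b : ℝ, 0 < a ∧ a ≤ b ∧ Real.log (b / a) ≤ H ∧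
    ENNReal.ofReal a • ν ≤ μ ∧ μ ≤ ENNReal.ofReal b • ν

theorem HilbertBounded.mono {H H' : ℝ} {μ ν : Measure X} (h : HilbertBounded H μ ν)
    (hH : H ≤ H') : HilbertBounded H' μ ν := by
  obtain ⟨a, b, h1, h2, h3, h4⟩ := h
  exact ⟨a, b, h1, h2, h3.trans hH, h4⟩

theorem real_bounds_of_smul_le {μ ν : Measure X} [IsFiniteMeasure μ] [IsFiniteMeasure ν] {a b : ℝ}
    (ha : 0 ≤ a) (hb : 0 ≤ b) (h1 : ENNReal.ofReal a • ν ≤ μ) (h2 : μ ≤ ENNReal.ofReal b • ν)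
    (A : Set X) : a * ν.real A ≤ μ.real A ∧ μ.real A ≤ b * ν.real A := by
  have h1 := h1 A
  have h2 := h2 A
  simp only [Measure.smul_apply, smul_eq_mul] at h1 h2
  constructor
  · have := ENNReal.toReal_mono (measure_ne_top μ A) h1
    rwa [ENNReal.toReal_mul, ENNReal.toReal_ofReal ha] at this
  · have := ENNReal.toReal_mono
      (ENNReal.mul_ne_top ENNReal.ofReal_ne_top (measure_ne_top ν A)) h2
    rwa [ENNReal.toReal_mul, ENNReal.toReal_ofReal hb] at this

theorem smul_le_of_real_le {μ ν : Measure X} [IsFiniteMeasure μ] [IsFiniteMeasure ν] {a : ℝ}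
    (ha : 0 ≤ a) (h : ∀ A, MeasurableSet A → a * ν.real A ≤ μ.real A) :
    ENNReal.ofReal a • ν ≤ μ := by
  rw [Measure.le_iff]
  intro A hA
  have := ENNReal.ofReal_le_ofReal (h A hA)
  rwa [ENNReal.ofReal_mul ha, ofReal_measureReal, ofReal_measureReal] at this

theorem le_smul_of_real_le {μ ν : Measure X} [IsFiniteMeasure μ] [IsFiniteMeasure ν] {b : ℝ}
    (hb : 0 ≤ b) (h : ∀ A, MeasurableSet A → μ.real A ≤ b * ν.real A) :
    μ ≤ ENNReal.ofReal b • ν := by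
  rw [Measure.le_iff]
  intro A hA
  have := ENNReal.ofReal_le_ofReal (h A hA)
  rwa [ENNReal.ofReal_mul hb, ofReal_measureReal, ofReal_measureReal] at this

/-- Projectivity: both constants get multiplied by `c / d`, so their quotient is unchanged. -/
theorem HilbertBounded.smul {H : ℝ} {μ ν : Measure X} (h : HilbertBounded H μ ν)
    {c d : ℝ≥0∞} (hc0 : c ≠ 0) (hc : c ≠ ∞) (hd0 : d ≠ 0) (hd : d ≠ ∞) :
    HilbertBounded H (c • μ) (d • ν) := by
  obtain ⟨a, b, h1, h2, h3, h4, h5⟩ := h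
  have pc : 0 < c.toReal := ENNReal.toReal_pos hc0 hc
  have pd : 0 < d.toReal := ENNReal.toReal_pos hd0 hd
  have key : ∀ x : ℝ, 0 ≤ x →
      ENNReal.ofReal (c.toReal * x / d.toReal) • d • ν = c • (ENNReal.ofReal x • ν) := by
    intro x hx
    rw [smul_smul, smul_smul, ENNReal.ofReal_div_of_pos pd, ENNReal.ofReal_mul pc.le,
      ENNReal.ofReal_toReal hc, ENNReal.ofReal_toReal hd, ENNReal.div_mul_cancel hd0 hd]
  refine ⟨c.toReal * a / d.toReal, c.toReal * b / d.toReal, by positivity, by gcongr, ?_, ?_, ?_⟩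
  · rwa [show c.toReal * b / d.toReal / (c.toReal * a / d.toReal) = b / a by field_simp]
  · rw [key a h1.le]; gcongr
  · rw [key b (h1.le.trans h2)]; gcongr

/-- A common density preserves both inequalities with the same constants, so a Bayes update never
increases the distance. -/
theorem HilbertBounded.withDensity {H : ℝ} {μ ν : Measure X} (h : HilbertBounded H μ ν)
    (f : X → ℝ≥0∞) : HilbertBounded H (μ.withDensity f) (ν.withDensity f) := by
  obtain ⟨a, b, h1, h2, h3, h4, h5⟩ := h
  have mono : ∀ {m m' : Measure X}, m ≤ m' → m.withDensity f ≤ m'.withDensity f := by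
    intro m m' hm
    rw [Measure.le_iff]
    intro A hA
    rw [withDensity_apply _ hA, withDensity_apply _ hA]
    exact lintegral_mono' (Measure.restrict_mono le_rfl hm) le_rfl
  refine ⟨a, b, h1, h2, h3, ?_, ?_⟩
  · rw [← withDensity_smul_measure]; exact mono h4
  · rw [← withDensity_smul_measure]; exact mono h5

theorem comp_real_apply (κ : Kernel X X) [IsMarkovKernel κ] (μ : Measure X) [IsFiniteMeasure μ]
    {A : Set X} (hA : MeasurableSet A) :
    (κ ∘ₘ μ).real A = ∫ x, (κ x).real A ∂μ := by
  rw [measureReal_def, Measure.bind_apply hA κ.aemeasurable, ← integral_toReal]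
  · rfl
  · exact (κ.measurable_coe hA).aemeasurable
  · exact ae_of_all _ fun x => measure_lt_top _ _

/-- Lower bounds on integrands transfer to the difference of dominated integrals. -/
theorem sub_integral_bounds {μ ν : Measure X} [IsFiniteMeasure μ] [IsFiniteMeasure ν] {a : ℝ}
    (ha : 0 ≤ a) (h : ENNReal.ofReal a • ν ≤ μ) {f : X → ℝ} (hf : Measurable f) {m m' : ℝ}
    (hm : ∀ x, m ≤ f x) (hm' : ∀ x, f x ≤ m') :
    m * (μ.real Set.univ - a * ν.real Set.univ) ≤ ∫ x, f x ∂μ - a * ∫ x, f x ∂ν ∧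
    ∫ x, f x ∂μ - a * ∫ x, f x ∂ν ≤ m' * (μ.real Set.univ - a * ν.real Set.univ) := by
  have hint : ∀ ρ : Measure X, IsFiniteMeasure ρ → Integrable f ρ := fun ρ _ =>
    Integrable.of_bound hf.aestronglyMeasurable (max |m| |m'|) <| ae_of_all _ fun x => by
      rw [Real.norm_eq_abs]
      exact abs_le_max_abs_abs (hm x) (hm' x)
  have hsm : ∀ g : X → ℝ, ∫ x, g x ∂(ENNReal.ofReal a • ν) = a * ∫ x, g x ∂ν := fun g => by
    rw [integral_smul_measure, ENNReal.toReal_ofReal ha, smul_eq_mul]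
  have i1 := hint μ inferInstance
  have i2 := hint ν inferInstance
  constructor
  · have := integral_mono_measure (f := fun x => f x - m) h
      (ae_of_all _ fun x => sub_nonneg.2 (hm x)) (i1.sub (integrable_const m))
    rw [hsm, integral_sub i1 (integrable_const m), integral_sub i2 (integrable_const m),
      integral_const, integral_const, smul_eq_mul, smul_eq_mul] at this
    linarith
  · have := integral_mono_measure (f := fun x => m' - f x) h
      (ae_of_all _ fun x => sub_nonneg.2 (hm' x)) ((integrable_const m').sub i1)
    rw [hsm, integral_sub (integrable_const m') i1, integral_sub (integrable_const m') i2,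
      integral_const, integral_const, smul_eq_mul, smul_eq_mul] at this
    linarith

theorem sub_integral_bounds' {μ ν : Measure X} [IsFiniteMeasure μ] [IsFiniteMeasure ν] {b : ℝ}
    (hb : 0 ≤ b) (h : μ ≤ ENNReal.ofReal b • ν) {f : X → ℝ} (hf : Measurable f) {m m' : ℝ}
    (hm : ∀ x, m ≤ f x) (hm' : ∀ x, f x ≤ m') :
    m * (b * ν.real Set.univ - μ.real Set.univ) ≤ b * ∫ x, f x ∂ν - ∫ x, f x ∂μ ∧
    b * ∫ x, f x ∂ν - ∫ x, f x ∂μ ≤ m' * (b * ν.real Set.univ - μ.real Set.univ) := by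
  have : IsFiniteMeasure (ENNReal.ofReal b • ν) := ν.smul_finite ENNReal.ofReal_ne_top
  have := sub_integral_bounds (μ := ENNReal.ofReal b • ν) (ν := μ) zero_le_one (by simpa using h)
    hf hm hm'
  simpa [measureReal_def, ENNReal.toReal_mul, ENNReal.toReal_ofReal hb] using this

theorem IsMixing.exists_bounds [Nonempty X] {κ : Kernel X X} [IsMarkovKernel κ] {e : ℝ}
    (h : IsMixing κ e) : ∃ lam : Set X → ℝ, ∀ x : X, ∀ A : Set X, MeasurableSet A →
      0 ≤ lam A ∧ e * lam A ≤ (κ x).real A ∧ (κ x).real A ≤ lam A / e := by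
  obtain ⟨h0, h1, lam, hlam⟩ := h
  refine ⟨fun A => lam.real A, fun x A hA => ?_⟩
  obtain ⟨l1, l2⟩ := hlam x A hA
  have hfin : lam A ≠ ∞ := by
    intro htop
    rw [htop, ENNReal.mul_top (by simpa using h0)] at l1
    exact measure_ne_top (κ x) A (top_le_iff.1 l1)
  refine ⟨measureReal_nonneg, ?_, ?_⟩
  · have := ENNReal.toReal_mono (measure_ne_top _ _) l1
    rwa [ENNReal.toReal_mul, ENNReal.toReal_ofReal h0.le] at this
  · have := ENNReal.toReal_mono (ENNReal.mul_ne_top ENNReal.ofReal_ne_top hfin) l2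
    rw [ENNReal.toReal_mul, ENNReal.toReal_ofReal (by positivity)] at this
    rw [div_eq_inv_mul, ← one_div]; exact this

theorem nonempty_of_measure_ne_zero {ν : Measure X} (h : ν ≠ 0) : Nonempty X := by
  by_contra hX
  rw [not_nonempty_iff] at hX
  exact h (Measure.eq_zero_of_isEmpty ν)

/-- Birkhoff contraction of the Hilbert metric under a mixing kernel. -/
theorem HilbertBounded.comp {H : ℝ} {μ ν : Measure X} [IsFiniteMeasure μ] [IsFiniteMeasure ν]
    (h : HilbertBounded H μ ν) (hν : ν ≠ 0) {κ : Kernel X X} [IsMarkovKernel κ] {e : ℝ}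
    (hκ : IsMixing κ e) :
    HilbertBounded ((1 - e ^ 2) / (1 + e ^ 2) * H) (κ ∘ₘ μ) (κ ∘ₘ ν) := by
  have := nonempty_of_measure_ne_zero hν
  obtain ⟨a, b, ha, hab, hH, h1, h2⟩ := h
  obtain ⟨lam, hlam⟩ := hκ.exists_bounds
  obtain ⟨he0, he1, -⟩ := hκ
  have hb : 0 < b := ha.trans_le hab
  have hk0 : 0 < e ^ 2 := by positivity
  have hk1 : e ^ 2 ≤ 1 := pow_le_one₀ he0.le he1
  obtain ⟨u1, u2⟩ := real_bounds_of_smul_le ha.le hb.le h1 h2 Set.univ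
  set k := e ^ 2 with hk
  -- `P` and `R` are the total masses of the nonnegative measures `μ - a ν` and `b ν - μ`, which are
  -- handled without subtracting measures.
  set P := μ.real Set.univ - a * ν.real Set.univ with hP
  set R := b * ν.real Set.univ - μ.real Set.univ with hR
  have hP0 : 0 ≤ P := sub_nonneg.2 u1
  have hR0 : 0 ≤ R := sub_nonneg.2 u2
  have hlogH : Real.log (b / a) * ((1 - k) / (1 + k)) ≤ H * ((1 - k) / (1 + k)) :=
    mul_le_mul_of_nonneg_right hH (div_nonneg (by linarith) (by linarith))
  have hPRb : P + R = (b - a) * ν.real Set.univ := by rw [hP, hR]; ring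
  have bound : ∀ A, MeasurableSet A →
      (e * lam A * P ≤ (κ ∘ₘ μ).real A - a * (κ ∘ₘ ν).real A ∧
        (κ ∘ₘ μ).real A - a * (κ ∘ₘ ν).real A ≤ lam A / e * P) ∧
      (e * lam A * R ≤ b * (κ ∘ₘ ν).real A - (κ ∘ₘ μ).real A ∧
        b * (κ ∘ₘ ν).real A - (κ ∘ₘ μ).real A ≤ lam A / e * R) := by
    intro A hA
    have hf : Measurable fun x => (κ x).real A := (κ.measurable_coe hA).ennreal_toReal
    have := sub_integral_bounds ha.le h1 hf (fun x => (hlam x A hA).2.1)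
      (fun x => (hlam x A hA).2.2)
    have := sub_integral_bounds' hb.le h2 hf (fun x => (hlam x A hA).2.1)
      (fun x => (hlam x A hA).2.2)
    rw [comp_real_apply κ μ hA, comp_real_apply κ ν hA]
    exact ⟨‹_›, ‹_›⟩
  -- If both masses vanish then `a = b` and `μ = a ν`: the distance is zero and the fractions used
  -- below would be `0 / 0`.
  rcases (add_nonneg hP0 hR0).eq_or_lt with h0 | hPR
  · have hνpos : 0 < ν.real Set.univ := by
      rw [measureReal_def]
      exact ENNReal.toReal_pos (by simpa using hν) (measure_ne_top _ _)
    have hba : b - a = 0 := by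
      rw [hPRb] at h0
      rcases mul_eq_zero.1 h0.symm with h | h
      · exact h
      · exact absurd h hνpos.ne'
    have hba : b = a := by linarith
    have hz : P = 0 := by linarith
    have hz' : R = 0 := by linarith
    refine ⟨a, a, ha, le_rfl, ?_, ?_, ?_⟩
    · rw [div_self ha.ne', Real.log_one]
      rw [hba, div_self ha.ne', Real.log_one, zero_mul] at hlogH
      linarith
    · refine smul_le_of_real_le ha.le fun A hA => ?_
      have := (bound A hA).1.1
      rw [hz, mul_zero] at this
      linarith
    · refine le_smul_of_real_le ha.le fun A hA => ?_
      have := (bound A hA).1.2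
      rw [hz, mul_zero] at this
      linarith
  · have hd1 : 0 < P + k * R := by
      rcases hP0.eq_or_lt with h | h
      · have : 0 < R := by linarith
        rw [← h, zero_add]; positivity
      · positivity
    have hd2 : 0 < k * P + R := by
      rcases hP0.eq_or_lt with h | h
      · have : 0 < R := by linarith
        rw [← h]; simpa
      · positivity
    have hn1 : a * (P + k * R) ≤ b * P + a * k * R := by nlinarith
    have hn2 : a * (k * P + R) ≤ b * k * P + a * R := by
      have : a * (k * P) ≤ b * (k * P) := mul_le_mul_of_nonneg_right hab (by positivity)
      linarith
    have ha' : a ≤ (b * k * P + a * R) / (k * P + R) := (le_div_iff₀ hd2).2 hn2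
    have hb' : a ≤ (b * P + a * k * R) / (P + k * R) := (le_div_iff₀ hd1).2 hn1
    -- Write `D` and `G` for the images of `μ - a ν` and `b ν - μ` under `κ`. Mixing forces the
    -- ratio `D A : G A` to lie between `k P : R` and `P : k R`, the unknown `lam A` cancelling.
    have hcross : ∀ A, MeasurableSet A →
        k * R * ((κ ∘ₘ μ).real A - a * (κ ∘ₘ ν).real A)
            ≤ P * (b * (κ ∘ₘ ν).real A - (κ ∘ₘ μ).real A) ∧
        k * P * (b * (κ ∘ₘ ν).real A - (κ ∘ₘ μ).real A)
            ≤ R * ((κ ∘ₘ μ).real A - a * (κ ∘ₘ ν).real A) := by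
      intro A hA
      obtain ⟨⟨b1, b2⟩, b3, b4⟩ := bound A hA
      have hke : ∀ x : ℝ, k * (lam A / e * x) = e * lam A * x := fun x => by
        rw [hk]; field_simp
      constructor
      · calc k * R * ((κ ∘ₘ μ).real A - a * (κ ∘ₘ ν).real A)
            ≤ k * R * (lam A / e * P) := by gcongr
          _ = R * (k * (lam A / e * P)) := by ring
          _ = P * (e * lam A * R) := by rw [hke]; ring
          _ ≤ _ := by gcongr
      · calc k * P * (b * (κ ∘ₘ ν).real A - (κ ∘ₘ μ).real A)
            ≤ k * P * (lam A / e * R) := by gcongr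
          _ = P * (k * (lam A / e * R)) := by ring
          _ = R * (e * lam A * P) := by rw [hke]; ring
          _ ≤ _ := by gcongr
    -- The ratio of the images of `μ` and `ν` is `(b D + a G) / (D + G)`, increasing in `D / G`; the
    -- new constants are its values at the two extreme ratios.
    refine ⟨(b * k * P + a * R) / (k * P + R), (b * P + a * k * R) / (P + k * R),
      ha.trans_le ha', ?_, ?_, ?_, ?_⟩
    · rw [div_le_div_iff₀ hd2 hd1]
      have h3 : 0 ≤ (b - a) * (1 - k) * (1 + k) * (P * R) :=
        mul_nonneg (mul_nonneg (mul_nonneg (by linarith) (by linarith)) (by linarith))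
          (mul_nonneg hP0 hR0)
      linarith
    · have := log_moebius_le hk0 hk1 ha hab hP0 hR0 hPR
      linarith
    · refine smul_le_of_real_le (ha.le.trans ha') fun A hA => ?_
      rw [div_mul_eq_mul_div, div_le_iff₀ hd2]
      have := (hcross A hA).2
      linarith
    · refine le_smul_of_real_le (ha.le.trans hb') fun A hA => ?_
      rw [div_mul_eq_mul_div, le_div_iff₀ hd1]
      have := (hcross A hA).1
      linarith

/-- The images of any two measures under a mixing kernel are comparable. -/
theorem IsMixing.hilbertBounded_comp {μ ν : Measure X} [IsFiniteMeasure μ] [IsFiniteMeasure ν]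
    (hμ : μ ≠ 0) (hν : ν ≠ 0) {κ : Kernel X X} [IsMarkovKernel κ] {e : ℝ} (hκ : IsMixing κ e) :
    HilbertBounded (Real.log (1 / e ^ 4)) (κ ∘ₘ μ) (κ ∘ₘ ν) := by
  have := nonempty_of_measure_ne_zero hν
  obtain ⟨lam, hlam⟩ := hκ.exists_bounds
  obtain ⟨he0, he1, -⟩ := hκ
  have pos : ∀ ρ : Measure X, IsFiniteMeasure ρ → ρ ≠ 0 → 0 < ρ.real Set.univ := fun ρ _ h => by
    rw [measureReal_def]
    exact ENNReal.toReal_pos (by simpa using h) (measure_ne_top _ _)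
  have pμ := pos μ inferInstance hμ
  have pν := pos ν inferInstance hν
  have bound : ∀ ρ : Measure X, IsFiniteMeasure ρ → ∀ A, MeasurableSet A →
      e * lam A * ρ.real Set.univ ≤ (κ ∘ₘ ρ).real A ∧
      (κ ∘ₘ ρ).real A ≤ lam A / e * ρ.real Set.univ := by
    intro ρ _ A hA
    have hf : Measurable fun x => (κ x).real A := (κ.measurable_coe hA).ennreal_toReal
    have := sub_integral_bounds (μ := ρ) (ν := 0) (a := 0) le_rfl (by simpa using Measure.zero_le ρ) hf
      (fun x => (hlam x A hA).2.1) (fun x => (hlam x A hA).2.2)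
    simpa [comp_real_apply κ ρ hA] using this
  set m := μ.real Set.univ
  set n := ν.real Set.univ
  -- Each image lies between `e` and `1 / e` times `lam A` times the total mass, so the two bounds
  -- on the ratio differ by the factor `1 / e ^ 4`.
  refine ⟨e ^ 2 * (m / n), 1 / e ^ 2 * (m / n), by positivity, ?_, ?_, ?_, ?_⟩
  · have h1 : e ^ 2 ≤ 1 := pow_le_one₀ he0.le he1
    have h2 : 1 ≤ 1 / e ^ 2 := (one_le_div (by positivity)).2 h1
    gcongr
    exact h1.trans h2
  · apply le_of_eq
    congr 1
    field_simp
  · refine smul_le_of_real_le (by positivity) fun A hA => ?_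
    calc e ^ 2 * (m / n) * (κ ∘ₘ ν).real A ≤ e ^ 2 * (m / n) * (lam A / e * n) := by
          gcongr; exact (bound ν inferInstance A hA).2
      _ = e * lam A * m := by field_simp
      _ ≤ _ := (bound μ inferInstance A hA).1
  · refine le_smul_of_real_le (by positivity) fun A hA => ?_
    calc (κ ∘ₘ μ).real A ≤ lam A / e * m := (bound μ inferInstance A hA).2
      _ = 1 / e ^ 2 * (m / n) * (e * lam A * n) := by field_simp
      _ ≤ _ := by gcongr; exact (bound ν inferInstance A hA).1

theorem infRatio_supRatio_bounds {μ ν : Measure X} [IsFiniteMeasure ν]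
    {a b : ℝ} (hν : ν ≠ 0) (h1 : ENNReal.ofReal a • ν ≤ μ)
    (h2 : μ ≤ ENNReal.ofReal b • ν) :
    ENNReal.ofReal a ≤ infRatio μ ν ∧ infRatio μ ν ≤ supRatio μ ν ∧
      supRatio μ ν ≤ ENNReal.ofReal b := by
  refine ⟨le_iInf fun A => ?_, ?_, iSup_le fun A => ?_⟩
  · rw [ENNReal.le_div_iff_mul_le (Or.inl A.2.2.ne') (Or.inl (measure_ne_top _ _))]
    exact h1 A
  -- Some set of positive `ν`-measure is needed: over an empty index the infimum would be `⊤` and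
  -- the supremum `0`.
  · have : 0 < ν Set.univ := by simpa [pos_iff_ne_zero] using hν
    exact (iInf_le _ ⟨Set.univ, MeasurableSet.univ, this⟩).trans
      (le_iSup (fun A : {A : Set X // MeasurableSet A ∧ 0 < ν A} => μ A / ν A)
        ⟨Set.univ, MeasurableSet.univ, this⟩)
  · exact ENNReal.div_le_of_le_mul (h2 A)

theorem HilbertBounded.hilbertMetric_le {H : ℝ} {μ ν : Measure X} [IsFiniteMeasure ν]
    (hν : ν ≠ 0) (h : HilbertBounded H μ ν) : hilbertMetric μ ν ≤ ENNReal.ofReal H := by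
  obtain ⟨a, b, ha, hab, hH, h1, h2⟩ := h
  have hb := ha.trans_le hab
  obtain ⟨r1, r2, r3⟩ := infRatio_supRatio_bounds hν h1 h2
  rw [hilbertMetric, if_neg (fun h => hν h.2), if_pos ⟨a, b, ha, hab, fun A _ => ⟨h1 A, h2 A⟩⟩]
  apply ENNReal.ofReal_le_ofReal
  refine le_trans ?_ hH
  have hsf : supRatio μ ν ≠ ∞ := (r3.trans_lt ENNReal.ofReal_lt_top).ne
  have hif : infRatio μ ν ≠ ∞ := (r2.trans_lt (lt_top_iff_ne_top.2 hsf)).ne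
  have i1 : a ≤ (infRatio μ ν).toReal := (ENNReal.ofReal_le_iff_le_toReal hif).1 r1
  have i2 : (infRatio μ ν).toReal ≤ (supRatio μ ν).toReal := ENNReal.toReal_mono hsf r2
  have i3 : (supRatio μ ν).toReal ≤ b := ENNReal.toReal_le_of_le_ofReal hb.le r3
  have ipos := ha.trans_le i1
  apply Real.log_le_log (div_pos (ipos.trans_le i2) ipos)
  gcongr

/-- The two extremal ratios are themselves admissible constants. Sets null for `ν` are invisible to
the ratios; comparability makes them null for `μ`. -/
theorem hilbertBounded_hilbertMetric {μ ν : Measure X} [IsFiniteMeasure μ] [IsFiniteMeasure ν]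
    (hν : ν ≠ 0) (h : hilbertMetric μ ν ≠ ∞) :
    HilbertBounded (hilbertMetric μ ν).toReal μ ν := by
  have h0 : ¬ (μ = 0 ∧ ν = 0) := fun h => hν h.2
  by_cases hc : Comparable μ ν
  swap
  · rw [hilbertMetric, if_neg h0, if_neg hc] at h
    exact absurd rfl h
  have hval : hilbertMetric μ ν
      = ENNReal.ofReal (Real.log ((supRatio μ ν).toReal / (infRatio μ ν).toReal)) := by
    rw [hilbertMetric, if_neg h0, if_pos hc]
  obtain ⟨a, b, ha, hab, hA⟩ := hc
  have hb := ha.trans_le hab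
  obtain ⟨r1, r2, r3⟩ := infRatio_supRatio_bounds (μ := μ) (b := b) hν
    (Measure.le_iff.2 fun A hA' => (hA A hA').1) (Measure.le_iff.2 fun A hA' => (hA A hA').2)
  have hsf : supRatio μ ν ≠ ∞ := (r3.trans_lt ENNReal.ofReal_lt_top).ne
  have hif : infRatio μ ν ≠ ∞ := (r2.trans_lt (lt_top_iff_ne_top.2 hsf)).ne
  have i1 : a ≤ (infRatio μ ν).toReal := (ENNReal.ofReal_le_iff_le_toReal hif).1 r1
  have i2 : (infRatio μ ν).toReal ≤ (supRatio μ ν).toReal := ENNReal.toReal_mono hsf r2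
  have ipos := ha.trans_le i1
  refine ⟨(infRatio μ ν).toReal, (supRatio μ ν).toReal, ipos, i2, ?_, ?_, ?_⟩
  · rw [hval, ENNReal.toReal_ofReal (Real.log_nonneg ((one_le_div ipos).2 i2))]
  · rw [ENNReal.ofReal_toReal hif, Measure.le_iff]
    intro A hA'
    rw [Measure.smul_apply, smul_eq_mul]
    rcases eq_or_ne (ν A) 0 with hz | hz
    · simp [hz]
    · have := iInf_le (fun A : {A : Set X // MeasurableSet A ∧ 0 < ν A} => μ A / ν A)
        ⟨A, hA', pos_iff_ne_zero.2 hz⟩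
      exact (ENNReal.le_div_iff_mul_le (Or.inl hz) (Or.inl (measure_ne_top _ _))).1 this
  · rw [ENNReal.ofReal_toReal hsf, Measure.le_iff]
    intro A hA'
    rw [Measure.smul_apply, smul_eq_mul]
    rcases eq_or_ne (ν A) 0 with hz | hz
    · have := (hA A hA').2
      rwa [hz, mul_zero] at this ⊢
    · have := le_iSup (fun A : {A : Set X // MeasurableSet A ∧ 0 < ν A} => μ A / ν A)
        ⟨A, hA', pos_iff_ne_zero.2 hz⟩
      exact (ENNReal.div_le_iff_le_mul (Or.inl hz) (Or.inl (measure_ne_top _ _))).1 this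

end HilbertBound

/-! ### Total variation against the Hilbert distance and against integrals. -/

section TotalVariation

variable {X : Type*} [MeasurableSpace X]

theorem bddAbove_abs_measureReal_sub (μ ν : Measure X) [IsProbabilityMeasure μ]
    [IsProbabilityMeasure ν] :
    BddAbove (Set.range fun B : {B : Set X // MeasurableSet B} => |μ.real B - ν.real B|) := by
  refine ⟨1, ?_⟩
  rintro _ ⟨B, rfl⟩
  have h1 : μ.real B ≤ 1 := measureReal_le_one
  have h2 : ν.real B ≤ 1 := measureReal_le_one
  have h3 : 0 ≤ μ.real B := measureReal_nonneg
  have h4 : 0 ≤ ν.real B := measureReal_nonneg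
  exact abs_le.2 ⟨by linarith, by linarith⟩

theorem tvDist_nonneg (μ ν : Measure X) : 0 ≤ tvDist μ ν :=
  mul_nonneg zero_le_two (Real.iSup_nonneg fun _ => abs_nonneg _)

theorem abs_measureReal_sub_le_tvDist (μ ν : Measure X) [IsProbabilityMeasure μ]
    [IsProbabilityMeasure ν] {B : Set X} (hB : MeasurableSet B) :
    |μ.real B - ν.real B| ≤ tvDist μ ν / 2 := by
  have := le_ciSup (bddAbove_abs_measureReal_sub μ ν) ⟨B, hB⟩
  rw [tvDist]
  simpa using this

/-- The total variation distance is at most the Hilbert distance. -/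
theorem HilbertBounded.tvDist_le {H : ℝ} {μ ν : Measure X} [IsProbabilityMeasure μ]
    [IsProbabilityMeasure ν] (h : HilbertBounded H μ ν) : tvDist μ ν ≤ H := by
  obtain ⟨a, b, ha, hab, hH, h1, h2⟩ := h
  have hb := ha.trans_le hab
  have hbd := real_bounds_of_smul_le ha.le hb.le h1 h2
  have h0 : 0 ≤ Real.log (b / a) := Real.log_nonneg ((one_le_div ha).2 hab)
  have key : ∀ B : Set X, MeasurableSet B →
      μ.real B - ν.real B ≤ H / 2 := by
    intro B hB
    set d := μ.real B - ν.real B with hd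
    rcases le_or_gt d 0 with hd0 | hd0
    · linarith
    have c1 : μ.real Bᶜ = 1 - μ.real B := probReal_compl_eq_one_sub hB
    have c2 : ν.real Bᶜ = 1 - ν.real B := probReal_compl_eq_one_sub hB
    have n1 : 0 ≤ ν.real B := measureReal_nonneg
    have n2 : 0 ≤ μ.real Bᶜ := measureReal_nonneg
    have b1 := (hbd B).2
    have b2 := (hbd Bᶜ).1
    have m1 : μ.real B ≤ 1 := measureReal_le_one
    have hν1 : 0 < 1 - ν.real B := by linarith
    have i1 : 1 ≤ b * (1 - d) := by
      have hb1 : 1 ≤ b := by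
        by_contra! hlt
        nlinarith
      nlinarith
    have i2 : a ≤ 1 - d := by
      have ha1 : a ≤ 1 := by
        have := (hbd Set.univ).1
        simpa using this
      nlinarith
    have hd1 : 0 < 1 - d := ha.trans_le i2
    -- The upper bound on `B` gives `1 / b ≤ 1 - d`, the lower bound on the complement gives `a ≤ 1
    -- - d`. Their product with `log (1 - d) ≤ -d` yields `2 * d ≤ log (b / a)`.
    have i3 : a / b ≤ (1 - d) ^ 2 := by
      rw [div_le_iff₀ hb]
      nlinarith
    have i4 : Real.log (a / b) ≤ 2 * Real.log (1 - d) := by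
      have := Real.log_le_log (div_pos ha hb) i3
      rwa [Real.log_pow, Nat.cast_ofNat] at this
    have i5 : Real.log (1 - d) ≤ -d := by
      have := Real.log_le_sub_one_of_pos hd1
      linarith
    have i6 : Real.log (b / a) = -Real.log (a / b) := by rw [← Real.log_inv, inv_div]
    linarith
  have : ⨆ B : {B : Set X // MeasurableSet B}, |μ.real B - ν.real B| ≤ H / 2 := by
    refine Real.iSup_le (fun B => abs_le.2 ⟨?_, key B B.2⟩) (by linarith)
    have := key _ B.2.compl
    rw [probReal_compl_eq_one_sub B.2, probReal_compl_eq_one_sub B.2] at this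
    linarith
  rw [tvDist]
  linarith

/-- Layer cake formula for `f + M`, with values in `[0, 2 * M]`: each level set contributes at most
`tvDist μ ν / 2`, over an interval of length `2 * M`. -/
theorem abs_integral_sub_le_tvDist (μ ν : Measure X) [IsProbabilityMeasure μ]
    [IsProbabilityMeasure ν] {f : X → ℝ} (hf : Measurable f) {M : ℝ} (hM : ∀ x, |f x| ≤ M) :
    |∫ x, f x ∂μ - ∫ x, f x ∂ν| ≤ M * tvDist μ ν := by
  have hX : Nonempty X := nonempty_of_measure_ne_zero (IsProbabilityMeasure.ne_zero μ)
  have hM0 : 0 ≤ M := (abs_nonneg _).trans (hM hX.some)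
  have hint : ∀ ρ : Measure X, IsProbabilityMeasure ρ → Integrable f ρ := fun ρ _ =>
    Integrable.of_bound hf.aestronglyMeasurable M (ae_of_all _ hM)
  have hlc : ∀ ρ : Measure X, IsProbabilityMeasure ρ →
      ∫ x, f x ∂ρ + M = ∫ t in Set.Ioc 0 (2 * M), ρ.real {x | t ≤ f x + M} := by
    intro ρ hρ
    rw [← Integrable.integral_eq_integral_Ioc_meas_le (μ := ρ) (f := fun x => f x + M)
      ((hint ρ hρ).add (integrable_const M))
      (ae_of_all _ fun x => by have := (abs_le.1 (hM x)).1; simp only [Pi.zero_apply]; linarith)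
      (ae_of_all _ fun x => by have := (abs_le.1 (hM x)).2; linarith),
      integral_add (hint ρ hρ) (integrable_const M)]
    simp
  have hti : ∀ ρ : Measure X, IsProbabilityMeasure ρ →
      IntegrableOn (fun t : ℝ => ρ.real {x | t ≤ f x + M}) (Set.Ioc 0 (2 * M)) := by
    intro ρ hρ
    have hanti : Antitone fun t : ℝ => ρ.real {x | t ≤ f x + M} := fun s t hst =>
      measureReal_mono fun x (hx : t ≤ f x + M) => hst.trans hx
    exact ⟨hanti.measurable.aestronglyMeasurable,
      HasFiniteIntegral.of_bounded (C := 1) (ae_of_all _ fun t => by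
        rw [Real.norm_of_nonneg measureReal_nonneg]; exact measureReal_le_one)⟩
  have heq : ∫ x, f x ∂μ - ∫ x, f x ∂ν = ∫ t in Set.Ioc 0 (2 * M),
      (μ.real {x | t ≤ f x + M} - ν.real {x | t ≤ f x + M}) := by
    rw [integral_sub (hti μ inferInstance) (hti ν inferInstance), ← hlc μ inferInstance,
      ← hlc ν inferInstance]
    ring
  rw [heq, ← Real.norm_eq_abs]
  refine (norm_setIntegral_le_of_norm_le_const (C := tvDist μ ν / 2) measure_Ioc_lt_top
    fun t _ => ?_).trans ?_
  · exact abs_measureReal_sub_le_tvDist μ ν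
      (measurableSet_le measurable_const (hf.add measurable_const))
  · rw [Real.volume_real_Ioc_of_le (by linarith)]
    apply le_of_eq
    ring

end TotalVariation

/-! ### Histories and windows as prefixes of infinite sequences. -/

section PolicySequences

variable {Y U : Type*}

/-- The actions of `γ` along a sequence of observations. -/
def actSeq (γ : Policy Y U) (y : ℕ → Y) (n : ℕ) : U := γ.act n fun i : Fin (n + 1) => y i

/-- The window of a pair of sequences. -/
def seqWindow (y : ℕ → Y) (u : ℕ → U) (N : ℕ) : Window Y U N :=
  (fun i => y i, fun i => u i)

/-- Working with full sequences avoids casts between `Fin` types; entries past the prefix are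
arbitrary and never matter. -/
theorem exists_seq_extension {Y : Type*} [Nonempty Y] {k : ℕ} (v : Fin k → Y) :
    ∃ y : ℕ → Y, v = fun i : Fin k => y i :=
  ⟨fun i => if h : i < k then v ⟨i, h⟩ else Classical.arbitrary Y,
    funext fun i => by simp only [Fin.is_lt, Fin.eta, dite_true]⟩

theorem seqWindow_surjective [Nonempty Y] [Nonempty U] {N : ℕ} (w : Window Y U N) :
    ∃ y u, seqWindow y u N = w := by
  obtain ⟨y, hy⟩ := exists_seq_extension w.1
  obtain ⟨u, hu⟩ := exists_seq_extension w.2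
  exact ⟨y, u, Prod.ext hy.symm hu.symm⟩

theorem actSeq_steer_of_lt {N : ℕ} (u : ℕ → U) (γ : Policy Y U) (y : ℕ → Y) {n : ℕ} (h : n < N) :
    actSeq (steer (fun i : Fin N => u i) γ) y n = u n := by
  rw [actSeq, Policy.act, steer, dif_pos h]

theorem actSeq_eq (γ : Policy Y U) (y : ℕ → Y) (n : ℕ) :
    actSeq γ y n = γ n (fun i => y i) fun i => actSeq γ y i := by
  rw [actSeq, Policy.act]; rfl

theorem actSeq_congr (γ : Policy Y U) {y y' : ℕ → Y} {n : ℕ} (h : ∀ i ≤ n, y i = y' i) :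
    actSeq γ y n = actSeq γ y' n := by
  rw [actSeq, actSeq]
  congr 1
  funext i
  exact h i (Nat.lt_succ_iff.1 i.2)

end PolicySequences

/-! ### The unnormalised filter recursion. -/

section Filter

variable {X Y U : Type*} [MeasurableSpace X] [MeasurableSpace Y] [MeasurableSpace U]

/-- The unnormalised Bayes update of `μ` after the observation `y`. -/
noncomputable def reweight (Q : Kernel X Y) (y : Y) (μ : Measure X) : Measure X :=
  μ.withDensity fun x => Q x {y}

/-- The unnormalised predictor: the law of `Xₙ` on the event that `y₀, …, yₙ₋₁` are observed. -/
noncomputable def prior (T : Kernel (X × U) X) (Q : Kernel X Y) (y : ℕ → Y) (u : ℕ → U)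
    (z : Measure X) : ℕ → Measure X
  | 0 => z
  | n + 1 => (T.sectL (u n)) ∘ₘ reweight Q (y n) (prior T Q y u z n)

/-- The unnormalised filter: the law of `Xₙ` on the event that `y₀, …, yₙ` are observed. -/
noncomputable def unnormFilter (T : Kernel (X × U) X) (Q : Kernel X Y) (y : ℕ → Y) (u : ℕ → U)
    (z : Measure X) (n : ℕ) : Measure X :=
  reweight Q (y n) (prior T Q y u z n)

variable (T : Kernel (X × U) X) (Q : Kernel X Y)

theorem prior_congr {y y' : ℕ → Y} {u u' : ℕ → U} (z : Measure X) {n : ℕ}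
    (hy : ∀ i < n, y i = y' i) (hu : ∀ i < n, u i = u' i) :
    prior T Q y u z n = prior T Q y' u' z n := by
  induction n with
  | zero => rfl
  | succ n ih =>
    rw [prior, prior, hy n n.lt_succ_self, hu n n.lt_succ_self,
      ih (fun i hi => hy i (hi.trans n.lt_succ_self)) fun i hi => hu i (hi.trans n.lt_succ_self)]

theorem unnormFilter_congr {y y' : ℕ → Y} {u u' : ℕ → U} (z : Measure X) {n : ℕ}
    (hy : ∀ i ≤ n, y i = y' i) (hu : ∀ i < n, u i = u' i) :
    unnormFilter T Q y u z n = unnormFilter T Q y' u' z n := by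
  rw [unnormFilter, unnormFilter, hy n le_rfl, prior_congr T Q z (fun i hi => hy i hi.le) hu]

/-- Restart property: the past before time `k` enters only through the predictor at `k`. -/
theorem prior_add (y : ℕ → Y) (u : ℕ → U) (z : Measure X) (k n : ℕ) :
    prior T Q y u z (k + n)
      = prior T Q (fun i => y (k + i)) (fun i => u (k + i)) (prior T Q y u z k) n := by
  induction n with
  | zero => rfl
  | succ n ih => rw [← add_assoc, prior, prior, ih]

theorem unnormFilter_add (y : ℕ → Y) (u : ℕ → U) (z : Measure X) (k n : ℕ) :
    unnormFilter T Q y u z (k + n)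
      = unnormFilter T Q (fun i => y (k + i)) (fun i => u (k + i)) (prior T Q y u z k) n := by
  rw [unnormFilter, unnormFilter, prior_add]

theorem reweight_smul (y : Y) (c : ℝ≥0∞) (μ : Measure X) :
    reweight Q y (c • μ) = c • reweight Q y μ := withDensity_smul_measure _ _

/-- Homogeneity lets the recursion restart from the normalised predictor, a probability measure; the
factor cancels on normalising again. -/
theorem prior_smul (y : ℕ → Y) (u : ℕ → U) (c : ℝ≥0∞) (z : Measure X) (n : ℕ) :
    prior T Q y u (c • z) n = c • prior T Q y u z n := by
  induction n with
  | zero => rfl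
  | succ n ih => rw [prior, prior, ih, reweight_smul, Measure.comp_smul]

theorem unnormFilter_smul (y : ℕ → Y) (u : ℕ → U) (c : ℝ≥0∞) (z : Measure X) (n : ℕ) :
    unnormFilter T Q y u (c • z) n = c • unnormFilter T Q y u z n := by
  rw [unnormFilter, prior_smul, reweight_smul]; rfl

instance [IsMarkovKernel T] (u : U) : IsMarkovKernel (T.sectL u) :=
  ⟨fun x => by rw [Kernel.sectL_apply]; infer_instance⟩

instance [IsMarkovKernel Q] (y : Y) (μ : Measure X) [IsFiniteMeasure μ] :
    IsFiniteMeasure (reweight Q y μ) := by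
  refine ⟨?_⟩
  rw [reweight, withDensity_apply _ MeasurableSet.univ, setLIntegral_univ]
  calc ∫⁻ x, Q x {y} ∂μ ≤ ∫⁻ _, 1 ∂μ := lintegral_mono fun x => prob_le_one
    _ < ∞ := by simp

instance [IsMarkovKernel T] [IsMarkovKernel Q] (y : ℕ → Y) (u : ℕ → U) (z : Measure X)
    [IsFiniteMeasure z] (n : ℕ) : IsFiniteMeasure (prior T Q y u z n) := by
  induction n with
  | zero => rw [prior]; infer_instance
  | succ n ih => rw [prior]; infer_instance

instance [IsMarkovKernel T] [IsMarkovKernel Q] (y : ℕ → Y) (u : ℕ → U) (z : Measure X)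
    [IsFiniteMeasure z] (n : ℕ) : IsFiniteMeasure (unnormFilter T Q y u z n) := by
  rw [unnormFilter]; infer_instance

section Positivity

variable {Q} {ε : ℝ}

theorem reweight_ne_zero [MeasurableSingletonClass Y] [IsMarkovKernel Q] (hε : 0 < ε)
    (hQ : ∀ (x : X) (y : Y), ε ≤ (Q x).real {y}) (y : Y) {μ : Measure X} (hμ : μ ≠ 0) :
    reweight Q y μ ≠ 0 := by
  rw [reweight, Ne, withDensity_eq_zero_iff (Q.measurable_coe (measurableSet_singleton y)).aemeasurable]
  intro h
  refine hμ (ae_eq_bot.1 (Filter.eventually_false_iff_eq_bot.1 ?_))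
  filter_upwards [h] with x hx
  have h1 := hQ x y
  rw [measureReal_def, hx] at h1
  simp only [Pi.zero_apply, ENNReal.toReal_zero] at h1
  linarith

theorem prior_ne_zero [MeasurableSingletonClass Y] [IsMarkovKernel T] [IsMarkovKernel Q]
    (hε : 0 < ε) (hQ : ∀ (x : X) (y : Y), ε ≤ (Q x).real {y}) (y : ℕ → Y) (u : ℕ → U)
    {z : Measure X} (hz : z ≠ 0) (n : ℕ) : prior T Q y u z n ≠ 0 := by
  induction n with
  | zero => exact hz
  | succ n ih =>
    rw [prior]
    intro h
    have h1 := congrArg (fun m => m Set.univ) h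
    simp only [Measure.comp_apply_univ, Measure.coe_zero, Pi.zero_apply,
      Measure.measure_univ_eq_zero] at h1
    exact reweight_ne_zero hε hQ _ ih h1

theorem unnormFilter_ne_zero [MeasurableSingletonClass Y] [IsMarkovKernel T] [IsMarkovKernel Q]
    (hε : 0 < ε) (hQ : ∀ (x : X) (y : Y), ε ≤ (Q x).real {y}) (y : ℕ → Y) (u : ℕ → U)
    {z : Measure X} (hz : z ≠ 0) (n : ℕ) : unnormFilter T Q y u z n ≠ 0 :=
  reweight_ne_zero hε hQ _ (prior_ne_zero T hε hQ y u hz n)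

end Positivity

end Filter

/-! ### The trajectory measure expressed through the filter recursion. -/

section PathMeasure

variable {X Y U : Type*} [MeasurableSpace X]
  [Fintype Y] [MeasurableSpace Y] [MeasurableSingletonClass Y]
  [Fintype U] [MeasurableSpace U] [MeasurableSingletonClass U]
  (T : Kernel (X × U) X) [IsMarkovKernel T] (Q : Kernel X Y) [IsMarkovKernel Q]

instance (γ : Policy Y U) (z : Measure X) [IsProbabilityMeasure z] :
    IsProbabilityMeasure (pathMeasure T Q γ z) := by
  unfold pathMeasure; infer_instance

@[fun_prop]
theorem measurable_obsAt (n : ℕ) : Measurable (obsAt n : (ℕ → X × Y) → Y) := by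
  unfold obsAt; fun_prop

@[fun_prop]
theorem measurable_stateAt (n : ℕ) : Measurable (stateAt n : (ℕ → X × Y) → X) := by
  unfold stateAt; fun_prop

theorem measurableSet_obsEvent {k : ℕ} (y : Fin k → Y) : MeasurableSet (obsEvent X y) := by
  rw [obsEvent, Set.ofPred_forall]
  exact MeasurableSet.iInter fun i => measurable_obsAt _ (measurableSet_singleton _)

/-- The law of the initial state and observation. -/
theorem pathMeasure_map_zero (γ : Policy Y U) (z : Measure X) [IsProbabilityMeasure z] :
    (pathMeasure T Q γ z).map (fun ω => ω 0) = z ⊗ₘ Q := by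
  have h : (fun ω : ℕ → X × Y => ω 0)
      = (MeasurableEquiv.piUnique fun _ : Finset.Iic 0 => X × Y) ∘ Preorder.frestrictLe 0 := by
    funext ω; rfl
  rw [h, ← Measure.map_map (MeasurableEquiv.measurable _) (by fun_prop), pathMeasure,
    Kernel.trajMeasure, Measure.map_comp _ _ (by fun_prop), Kernel.traj_map_frestrictLe,
    Kernel.partialTraj_self, Measure.id_comp,
    Measure.map_map (MeasurableEquiv.measurable _) (MeasurableEquiv.measurable _),
    MeasurableEquiv.self_comp_symm, Measure.map_id]

/-- The law of the next state and observation on the event of a given observation history. -/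
theorem pathMeasure_step (γ : Policy Y U) (z : Measure X) [IsProbabilityMeasure z] (y : ℕ → Y)
    (n : ℕ) {B : Set (X × Y)} (hB : MeasurableSet B) :
    pathMeasure T Q γ z (obsEvent X (fun i : Fin (n + 1) => y i) ∩ {ω | ω (n + 1) ∈ B})
      = ∫⁻ x, (T ⊗ₖ Kernel.prodMkLeft (X × U) Q) (x, actSeq γ y n) B
        ∂((pathMeasure T Q γ z).restrict (obsEvent X fun i : Fin (n + 1) => y i)).map
          (stateAt n) := by
  set P := pathMeasure T Q γ z with hP
  set S : Set (Finset.Iic n → X × Y) :=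
    {h | ∀ i : Fin (n + 1), (h ⟨i.1, Finset.mem_Iic.2 (Nat.lt_succ_iff.1 i.2)⟩).2 = y i} with hS
  have hSm : MeasurableSet S := by
    rw [hS, Set.ofPred_forall]
    refine MeasurableSet.iInter fun i => ?_
    have : Measurable fun h : Finset.Iic n → X × Y =>
        (h ⟨i.1, Finset.mem_Iic.2 (Nat.lt_succ_iff.1 i.2)⟩).2 := by fun_prop
    exact this (measurableSet_singleton _)
  have hmap : (P.map (Preorder.frestrictLe n)) ⊗ₘ stepKernel T Q γ n
      = P.map (fun ω => (Preorder.frestrictLe n ω, ω (n + 1))) :=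
    Kernel.map_frestrictLe_trajMeasure_compProd_eq_map_trajMeasure
  have h1 := congrArg (fun m => m (S ×ˢ B)) hmap
  rw [Measure.map_apply (by fun_prop) (hSm.prod hB), Measure.compProd_apply_prod hSm hB,
    setLIntegral_map hSm ((stepKernel T Q γ n).measurable_coe hB) (by fun_prop)] at h1
  have hg : Measurable fun x =>
      (T ⊗ₖ Kernel.prodMkLeft (X × U) Q) (x, actSeq γ y n) B :=
    ((T ⊗ₖ Kernel.prodMkLeft (X × U) Q).measurable_coe hB).comp
      (measurable_id.prodMk measurable_const)
  rw [lintegral_map hg (by fun_prop)]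
  have h2 : (fun ω : ℕ → X × Y => (Preorder.frestrictLe n ω, ω (n + 1))) ⁻¹' S ×ˢ B
      = obsEvent X (fun i : Fin (n + 1) => y i) ∩ {ω | ω (n + 1) ∈ B} := by
    ext ω; rfl
  rw [h2] at h1
  rw [← h1]
  -- A policy is deterministic, so on a fixed observation history its action is the constant `actSeq
  -- γ y n`, and only the law of the state remains.
  refine setLIntegral_congr_fun (measurableSet_obsEvent _) fun ω hω => ?_
  have hω' : ∀ i : Fin (n + 1), (ω i.1).2 = y i := hω
  change stepKernel T Q γ n (Preorder.frestrictLe n ω) B = _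
  rw [stepKernel, Kernel.comap_apply]
  congr 2
  refine Prod.ext rfl ?_
  change γ.act n (fun i : Fin (n + 1) => (ω i.1).2) = γ.act n _
  congr 1
  funext i
  exact hω' i

theorem obsEvent_succ (y : ℕ → Y) (n : ℕ) :
    obsEvent X (fun i : Fin (n + 1) => y i)
      = obsEvent X (fun i : Fin n => y i) ∩ {ω | (ω n).2 = y n} := by
  ext ω
  simp only [obsEvent, Set.mem_ofPred_eq, Set.mem_inter_iff, Fin.forall_fin_succ']
  rfl

/-- The law of the state on the event of a given observation history. -/
theorem pathMeasure_restrict_map (γ : Policy Y U) (z : Measure X) [IsProbabilityMeasure z]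
    (y : ℕ → Y) (n : ℕ) :
    ((pathMeasure T Q γ z).restrict (obsEvent X fun i : Fin n => y i)).map (stateAt n)
        = prior T Q y (actSeq γ y) z n ∧
    ((pathMeasure T Q γ z).restrict (obsEvent X fun i : Fin (n + 1) => y i)).map (stateAt n)
        = unnormFilter T Q y (actSeq γ y) z n := by
  set P := pathMeasure T Q γ z with hP
  have e1 : ∀ n (A : Set X), MeasurableSet A →
      (P.restrict (obsEvent X fun i : Fin n => y i)).map (stateAt n) A
        = P (obsEvent X (fun i : Fin n => y i) ∩ {ω | ω n ∈ A ×ˢ Set.univ}) := by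
    intro n A hA
    rw [Measure.map_apply (by fun_prop) hA, Measure.restrict_apply (measurable_stateAt n hA),
      Set.inter_comm]
    congr 1
    ext ω
    simp [stateAt]
  have e2 : ∀ n (A : Set X), MeasurableSet A →
      (P.restrict (obsEvent X fun i : Fin (n + 1) => y i)).map (stateAt n) A
        = P (obsEvent X (fun i : Fin n => y i) ∩ {ω | ω n ∈ A ×ˢ {y n}}) := by
    intro n A hA
    rw [Measure.map_apply (by fun_prop) hA, Measure.restrict_apply (measurable_stateAt n hA),
      obsEvent_succ]
    congr 1
    ext ω
    simp only [stateAt, Set.mem_inter_iff, Set.mem_preimage, Set.mem_ofPred_eq, Set.mem_prod,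
      Set.mem_singleton_iff]
    tauto
  have hA' : ∀ (A : Set X) (y : Y), MeasurableSet A → MeasurableSet (A ×ˢ ({y} : Set Y)) :=
    fun A y hA => hA.prod (measurableSet_singleton y)
  have hw : ∀ (m : Measure X) (y : Y) (A : Set X), MeasurableSet A →
      reweight Q y m A = ∫⁻ x in A, Q x {y} ∂m := fun m y A hA => withDensity_apply _ hA
  -- Both laws are proved together: the next predictor is built from the current filter.
  induction n with
  | zero =>
    have h0 : ∀ B : Set (X × Y), MeasurableSet B →
        P (obsEvent X (fun i : Fin 0 => y i) ∩ {ω | ω 0 ∈ B}) = (z ⊗ₘ Q) B := by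
      intro B hB
      rw [← pathMeasure_map_zero T Q γ z, Measure.map_apply (by fun_prop) hB, hP]
      congr 1
      ext ω
      simp [obsEvent]
    constructor
    · ext A hA
      rw [e1 0 A hA, h0 _ (hA.prod MeasurableSet.univ),
        Measure.compProd_apply_prod hA MeasurableSet.univ]
      simp [prior]
    · ext A hA
      rw [e2 0 A hA, h0 _ (hA' A _ hA),
        Measure.compProd_apply_prod hA (measurableSet_singleton _), unnormFilter, hw _ _ _ hA]
      rfl
  | succ n ih =>
    have hstep : ∀ B : Set (X × Y), MeasurableSet B →
        P (obsEvent X (fun i : Fin (n + 1) => y i) ∩ {ω | ω (n + 1) ∈ B})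
          = ∫⁻ x, (T ⊗ₖ Kernel.prodMkLeft (X × U) Q) (x, actSeq γ y n) B
            ∂unnormFilter T Q y (actSeq γ y) z n := by
      intro B hB
      rw [hP, pathMeasure_step T Q γ z y n hB, ← hP, ih.2]
    constructor
    · ext A hA
      rw [e1 (n + 1) A hA, hstep _ (hA.prod MeasurableSet.univ), prior,
        Measure.bind_apply hA (Kernel.aemeasurable _)]
      refine lintegral_congr fun x => ?_
      rw [Kernel.compProd_apply_prod hA MeasurableSet.univ]
      simp
    · ext A hA
      rw [e2 (n + 1) A hA, hstep _ (hA' A _ hA), unnormFilter.eq_def _ _ _ _ _ (n + 1), hw _ _ _ hA, prior,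
        ← lintegral_indicator hA,
        Measure.lintegral_bind (Kernel.aemeasurable _)
          ((Q.measurable_coe (measurableSet_singleton _)).indicator hA).aemeasurable]
      refine lintegral_congr fun x => ?_
      rw [Kernel.compProd_apply_prod hA (measurableSet_singleton _), lintegral_indicator hA]
      rfl

theorem pathMeasure_obsEvent (γ : Policy Y U) (z : Measure X) [IsProbabilityMeasure z]
    (y : ℕ → Y) (n : ℕ) :
    pathMeasure T Q γ z (obsEvent X fun i : Fin (n + 1) => y i)
      = unnormFilter T Q y (actSeq γ y) z n Set.univ := by
  rw [← (pathMeasure_restrict_map T Q γ z y n).2, Measure.map_apply (by fun_prop) .univ]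
  simp

theorem unnormFilter_univ_succ (y : ℕ → Y) (u : ℕ → U) (z : Measure X) [IsFiniteMeasure z]
    (n : ℕ) : unnormFilter T Q y u z (n + 1) Set.univ
      = ∫⁻ x, (Q ∘ₖ T.sectL (u n)) x {y (n + 1)} ∂unnormFilter T Q y u z n := by
  rw [unnormFilter, reweight, withDensity_apply _ .univ, setLIntegral_univ, prior,
    Measure.lintegral_bind (Kernel.aemeasurable _)
      (Q.measurable_coe (measurableSet_singleton _)).aemeasurable]
  refine lintegral_congr fun x => ?_
  rw [Kernel.comp_apply' _ _ _ (measurableSet_singleton _)]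

variable [Nonempty U]

/-- Before time `N` the steered policy plays the prescribed actions, so `defaultPolicy` leaves no
trace; conditioning amounts to dividing by the total mass. -/
theorem posterior_seqWindow (z : Measure X) [IsProbabilityMeasure z] (y : ℕ → Y) (u : ℕ → U)
    (N : ℕ) : posterior T Q z (seqWindow y u N)
      = (unnormFilter T Q y u z N Set.univ)⁻¹ • unnormFilter T Q y u z N := by
  have h := unnormFilter_congr T Q (y := y) (y' := y) z (n := N) (fun _ _ => rfl)
    fun i hi => actSeq_steer_of_lt (N := N) u (defaultPolicy Y U) y hi
  rw [posterior, ProbabilityTheory.cond, Measure.map_smul]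
  simp only [seqWindow]
  rw [(pathMeasure_restrict_map T Q _ z y N).2, pathMeasure_obsEvent, h]

theorem predictor_seq (z : Measure X) [IsProbabilityMeasure z] (y : ℕ → Y) (u : ℕ → U)
    (t : ℕ) : predictor T Q z (fun i : Fin t => y i) (fun i : Fin t => u i)
      = (prior T Q y u z t Set.univ)⁻¹ • prior T Q y u z t := by
  have h := prior_congr T Q (y := y) (y' := y) z (n := t) (fun _ _ => rfl)
    fun i hi => actSeq_steer_of_lt (N := t) u (defaultPolicy Y U) y hi
  have h' := (pathMeasure_restrict_map T Q (steer (fun i : Fin t => u i) (defaultPolicy Y U))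
    z y t).1
  have h'' : pathMeasure T Q (steer (fun i : Fin t => u i) (defaultPolicy Y U)) z
      (obsEvent X fun i : Fin t => y i) = prior T Q y u z t Set.univ := by
    rw [← h, ← h', Measure.map_apply (by fun_prop) .univ]
    simp
  rw [predictor, ProbabilityTheory.cond, Measure.map_smul, h', h'', h]

end PathMeasure

/-! ### The rate `r` dominates every Birkhoff coefficient and stays below one. -/

section Constants

variable {U : Type*} [Fintype U] [Nonempty U]

/-- The map `s ↦ (1 - s) / (1 + s)` decreases, so inserting `ε ≤ 1` only enlarges the rate.
Finiteness of `U` makes the supremum a maximum, hence strictly below one. -/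
theorem contractionRate_bounds {ε : ℝ} (hε : 0 < ε) (hε1 : ε ≤ 1) {e : U → ℝ} (he0 : ∀ u, 0 < e u)
    (he1 : ∀ u, e u ≤ 1) :
    (∀ u, (1 - e u ^ 2) / (1 + e u ^ 2) ≤ ⨆ u : U, (1 - e u ^ 2 * ε) / (1 + e u ^ 2 * ε)) ∧
      0 ≤ (⨆ u : U, (1 - e u ^ 2 * ε) / (1 + e u ^ 2 * ε)) ∧
      (⨆ u : U, (1 - e u ^ 2 * ε) / (1 + e u ^ 2 * ε)) < 1 := by
  have hle : ∀ u, (1 - e u ^ 2 * ε) / (1 + e u ^ 2 * ε)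
      ≤ ⨆ u : U, (1 - e u ^ 2 * ε) / (1 + e u ^ 2 * ε) := fun u =>
    le_ciSup (f := fun u => (1 - e u ^ 2 * ε) / (1 + e u ^ 2 * ε)) (Set.finite_range _).bddAbove u
  have hsq : ∀ u, 0 < e u ^ 2 := fun u => pow_pos (he0 u) 2
  have hsq1 : ∀ u, e u ^ 2 ≤ 1 := fun u => pow_le_one₀ (he0 u).le (he1 u)
  refine ⟨fun u => le_trans ?_ (hle u), ?_, ?_⟩
  · have h1 := hsq u
    have h2 : e u ^ 2 * ε ≤ e u ^ 2 := mul_le_of_le_one_right h1.le hε1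
    have h3 : 0 < e u ^ 2 * ε := by positivity
    rw [div_le_div_iff₀ (by linarith) (by linarith)]
    linarith
  · obtain ⟨u⟩ := ‹Nonempty U›
    refine le_trans ?_ (hle u)
    have : e u ^ 2 * ε ≤ 1 := mul_le_one₀ (hsq1 u) hε.le hε1
    have := hsq u
    exact div_nonneg (by linarith) (by positivity)
  · obtain ⟨u, hu⟩ := exists_eq_ciSup_of_finite (f := fun u : U =>
      (1 - e u ^ 2 * ε) / (1 + e u ^ 2 * ε))
    rw [← hu]
    have : 0 < e u ^ 2 * ε := mul_pos (hsq u) hε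
    rw [div_lt_one (by positivity)]
    linarith

end Constants

/-! ### Exponential filter stability, uniform in the initial law. -/

section Stability

variable {X Y U : Type*} [MeasurableSpace X]
  [Fintype Y] [MeasurableSpace Y] [MeasurableSingletonClass Y]
  [Fintype U] [MeasurableSpace U] [MeasurableSingletonClass U] [Nonempty U]
  {T : Kernel (X × U) X} [IsMarkovKernel T] {Q : Kernel X Y} [IsMarkovKernel Q]

theorem isProbabilityMeasure_normalize {μ : Measure X} [IsFiniteMeasure μ] (hμ : μ ≠ 0) :
    IsProbabilityMeasure ((μ Set.univ)⁻¹ • μ) := by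
  have : NeZero μ := ⟨hμ⟩
  infer_instance

theorem nonempty_obs_of_measure (Q : Kernel X Y) [IsMarkovKernel Q] (z : Measure X)
    [IsProbabilityMeasure z] : Nonempty Y := by
  obtain ⟨x⟩ := nonempty_of_measure_ne_zero (IsProbabilityMeasure.ne_zero z)
  exact nonempty_of_measure_ne_zero (IsProbabilityMeasure.ne_zero (Q x))

variable {ε : ℝ} (hε : 0 < ε) (hQ : ∀ (x : X) (y : Y), ε ≤ (Q x).real {y})
include hε hQ

omit hε in
theorem le_one_of_channel_bound (z : Measure X) [IsProbabilityMeasure z] : ε ≤ 1 := by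
  obtain ⟨x⟩ := nonempty_of_measure_ne_zero (IsProbabilityMeasure.ne_zero z)
  obtain ⟨y⟩ := nonempty_obs_of_measure Q z
  exact (hQ x y).trans measureReal_le_one

theorem isProbabilityMeasure_posterior (z : Measure X) [IsProbabilityMeasure z] {N : ℕ}
    (w : Window Y U N) : IsProbabilityMeasure (posterior T Q z w) := by
  have := nonempty_obs_of_measure Q z
  obtain ⟨y, u, rfl⟩ := seqWindow_surjective w
  rw [posterior_seqWindow]
  exact isProbabilityMeasure_normalize
    (unnormFilter_ne_zero T hε hQ y u (IsProbabilityMeasure.ne_zero z) N)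

theorem isProbabilityMeasure_predictor (z : Measure X) [IsProbabilityMeasure z] {t : ℕ}
    (y : ℕ → Y) (u : ℕ → U) :
    IsProbabilityMeasure (predictor T Q z (fun i : Fin t => y i) fun i : Fin t => u i) := by
  rw [predictor_seq]
  exact isProbabilityMeasure_normalize
    (prior_ne_zero T hε hQ y u (IsProbabilityMeasure.ne_zero z) t)

variable {e : U → ℝ} (hT : ∀ u : U, IsMixing (T.sectL u) (e u))
include hT

theorem supHilbert_lt_top (zs : Measure X) [IsProbabilityMeasure zs] : supHilbert T Q zs < ⊤ := by
  have := nonempty_obs_of_measure Q zs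
  -- Only finiteness matters: the sum over all actions bounds each single term, whatever the first
  -- action is.
  set b : ℝ≥0∞ := ∑ u : U, ENNReal.ofReal (Real.log (1 / e u ^ 4)) with hb
  have hbt : b < ⊤ := ENNReal.sum_lt_top.2 fun u _ => ENNReal.ofReal_lt_top
  refine lt_of_le_of_lt (iSup_le fun z => iSup_le fun w => ?_) hbt
  obtain ⟨y, u, rfl⟩ := seqWindow_surjective w
  have hne : ∀ ρ : Measure X, ρ ≠ 0 → unnormFilter T Q y u ρ 1 ≠ 0 := fun ρ hρ =>
    unnormFilter_ne_zero T hε hQ y u hρ 1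
  have hz : (z : Measure X) ≠ 0 := IsProbabilityMeasure.ne_zero _
  have hzs : zs ≠ 0 := IsProbabilityMeasure.ne_zero _
  have h1 : HilbertBounded (Real.log (1 / e (u 0) ^ 4)) (unnormFilter T Q y u z 1)
      (unnormFilter T Q y u zs 1) :=
    ((hT (u 0)).hilbertBounded_comp (reweight_ne_zero hε hQ (y 0) hz)
      (reweight_ne_zero hε hQ (y 0) hzs)).withDensity _
  have h2 := h1.smul (c := (unnormFilter T Q y u z 1 Set.univ)⁻¹)
    (d := (unnormFilter T Q y u zs 1 Set.univ)⁻¹)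
    (ENNReal.inv_ne_zero.2 (measure_ne_top _ _))
    (ENNReal.inv_ne_top.2 (by simpa using hne z hz))
    (ENNReal.inv_ne_zero.2 (measure_ne_top _ _))
    (ENNReal.inv_ne_top.2 (by simpa using hne zs hzs))
  rw [← posterior_seqWindow, ← posterior_seqWindow] at h2
  have := isProbabilityMeasure_posterior (T := T) hε hQ zs (seqWindow y u 1)
  refine (h2.hilbertMetric_le (IsProbabilityMeasure.ne_zero _)).trans ?_
  exact Finset.single_le_sum (f := fun u => ENNReal.ofReal (Real.log (1 / e u ^ 4)))
    (fun _ _ => zero_le) (Finset.mem_univ (u 0))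

/-- The base case is time `1`, where the bound is the supremum defining `K`, transferred from
posteriors by projectivity. Each later step is one Birkhoff contraction followed by a harmless
reweighting. -/
theorem hilbertBounded_unnormFilter (z zs : Measure X) [IsProbabilityMeasure z]
    [IsProbabilityMeasure zs] {r : ℝ} (hr0 : 0 ≤ r)
    (hr : ∀ u, (1 - e u ^ 2) / (1 + e u ^ 2) ≤ r) (y : ℕ → Y) (u : ℕ → U) (n : ℕ) :
    HilbertBounded (r ^ n * (supHilbert T Q zs).toReal) (unnormFilter T Q y u z (n + 1))
      (unnormFilter T Q y u zs (n + 1)) := by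
  have hz : z ≠ 0 := IsProbabilityMeasure.ne_zero _
  have hzs : zs ≠ 0 := IsProbabilityMeasure.ne_zero _
  induction n with
  | zero =>
    have hle : hilbertMetric (posterior T Q z (seqWindow y u 1))
        (posterior T Q zs (seqWindow y u 1)) ≤ supHilbert T Q zs :=
      le_iSup_of_le (⟨z, inferInstance⟩ : ProbabilityMeasure X)
        (le_iSup (fun w : Window Y U 1 =>
          hilbertMetric (posterior T Q z w) (posterior T Q zs w)) (seqWindow y u 1))
    have htop := supHilbert_lt_top hε hQ hT zs
    have := isProbabilityMeasure_posterior (T := T) hε hQ z (seqWindow y u 1)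
    have := isProbabilityMeasure_posterior (T := T) hε hQ zs (seqWindow y u 1)
    have h1 := (hilbertBounded_hilbertMetric (IsProbabilityMeasure.ne_zero _)
      (hle.trans_lt htop).ne).mono (ENNReal.toReal_mono htop.ne hle)
    rw [posterior_seqWindow, posterior_seqWindow] at h1
    have n1 := unnormFilter_ne_zero T hε hQ y u hz 1
    have n2 := unnormFilter_ne_zero T hε hQ y u hzs 1
    have h2 := h1.smul (c := unnormFilter T Q y u z 1 Set.univ)
      (d := unnormFilter T Q y u zs 1 Set.univ) (by simpa using n1)
      (measure_ne_top _ _) (by simpa using n2) (measure_ne_top _ _)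
    rw [smul_smul, smul_smul, ENNReal.mul_inv_cancel (by simpa using n1) (measure_ne_top _ _),
      ENNReal.mul_inv_cancel (by simpa using n2) (measure_ne_top _ _), one_smul, one_smul] at h2
    simpa using h2
  | succ n ih =>
    have h1 := (ih.comp (unnormFilter_ne_zero T hε hQ y u hzs (n + 1))
      (hT (u (n + 1)))).withDensity fun x => Q x {y (n + 2)}
    refine HilbertBounded.mono h1 ?_
    have h0 : 0 ≤ r ^ n * (supHilbert T Q zs).toReal :=
      mul_nonneg (pow_nonneg hr0 n) ENNReal.toReal_nonneg
    calc _ ≤ r * (r ^ n * (supHilbert T Q zs).toReal) :=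
          mul_le_mul_of_nonneg_right (hr _) h0
      _ = _ := by ring

/-- Exponential stability of the finite window posteriors, uniformly in the initial law. -/
theorem tvDist_posterior_le (z zs : Measure X) [IsProbabilityMeasure z] [IsProbabilityMeasure zs]
    {r : ℝ} (hr0 : 0 ≤ r) (hr : ∀ u, (1 - e u ^ 2) / (1 + e u ^ 2) ≤ r) {N : ℕ} (hN : 1 ≤ N)
    (w : Window Y U N) :
    tvDist (posterior T Q z w) (posterior T Q zs w) ≤ r ^ (N - 1) * stabilityConst T Q zs := by
  have := nonempty_obs_of_measure Q z
  have hz : z ≠ 0 := IsProbabilityMeasure.ne_zero _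
  have hzs : zs ≠ 0 := IsProbabilityMeasure.ne_zero _
  obtain ⟨n, rfl⟩ := Nat.exists_eq_add_of_le' hN
  have p1 := isProbabilityMeasure_posterior (T := T) hε hQ z w
  have p2 := isProbabilityMeasure_posterior (T := T) hε hQ zs w
  obtain ⟨y, u, rfl⟩ := seqWindow_surjective w
  have n1 := unnormFilter_ne_zero T hε hQ y u hz (n + 1)
  have n2 := unnormFilter_ne_zero T hε hQ y u hzs (n + 1)
  have h1 := (hilbertBounded_unnormFilter hε hQ hT z zs hr0 hr y u n).smul
    (c := (unnormFilter T Q y u z (n + 1) Set.univ)⁻¹)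
    (d := (unnormFilter T Q y u zs (n + 1) Set.univ)⁻¹)
    (ENNReal.inv_ne_zero.2 (measure_ne_top _ _)) (ENNReal.inv_ne_top.2 (by simpa using n1))
    (ENNReal.inv_ne_zero.2 (measure_ne_top _ _)) (ENNReal.inv_ne_top.2 (by simpa using n2))
  rw [← posterior_seqWindow, ← posterior_seqWindow] at h1
  refine h1.tvDist_le.trans ?_
  rw [Nat.add_sub_cancel, stabilityConst]
  -- Total variation is already bounded by the Hilbert distance with constant `1`; the prefactor `2
  -- / log 3` in `K` is at least that.
  have hlog : Real.log 3 ≤ 2 := by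
    have := Real.log_le_sub_one_of_pos (x := 3) (by norm_num)
    linarith
  have hlog0 : 0 < Real.log 3 := Real.log_pos (by norm_num)
  refine mul_le_mul_of_nonneg_left ?_ (pow_nonneg hr0 n)
  exact le_mul_of_one_le_left ENNReal.toReal_nonneg ((one_le_div hlog0).2 hlog)

omit hε hQ hT in
theorem stabilityConst_nonneg (zs : Measure X) : 0 ≤ stabilityConst T Q zs :=
  mul_nonneg (div_nonneg zero_le_two (Real.log_nonneg (by norm_num))) ENNReal.toReal_nonneg

/-- The predictor on each trajectory is a probability measure, so the uniform posterior bound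
applies pathwise, for any policy. -/
theorem filterStability_le (z zs : Measure X) [IsProbabilityMeasure z] [IsProbabilityMeasure zs]
    {r : ℝ} (hr0 : 0 ≤ r) (hr : ∀ u, (1 - e u ^ 2) / (1 + e u ^ 2) ≤ r) {N : ℕ} (hN : 1 ≤ N)
    (t : ℕ) : filterStability T Q z zs N t ≤ r ^ (N - 1) * stabilityConst T Q zs := by
  refine Real.iSup_le (fun γ => ?_) (mul_nonneg (pow_nonneg hr0 _) (stabilityConst_nonneg zs))
  refine (Real.le_norm_self _).trans ((norm_integral_le_of_norm_le_const
    (C := r ^ (N - 1) * stabilityConst T Q zs) (ae_of_all _ fun ω => ?_)).trans (by simp))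
  have : IsProbabilityMeasure (predictorAt T Q γ.1 z t ω) :=
    isProbabilityMeasure_predictor hε hQ z (fun i => obsAt i ω) fun i => actionAt γ.1 i ω
  rw [Real.norm_of_nonneg (tvDist_nonneg _ _)]
  exact tvDist_posterior_le hε hQ hT _ zs hr0 hr hN _

end Stability

/-! ### Summing one-step errors with discounting. -/

section Telescoping

/-- A one-step lower bound on a discounted cost sums to a lower bound on the total cost. -/
theorem discounted_lower_bound {β B C : ℝ} (hβ0 : 0 ≤ β) (hβ1 : β < 1) {a j : ℕ → ℝ}
    (ha : ∀ t, |a t| ≤ C) (hj : ∀ t, |j t| ≤ C) (h : ∀ t, -B ≤ a t + β * j (t + 1) - j t) :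
    j 0 - B / (1 - β) ≤ ∑' t, β ^ t * a t := by
  have hgeo := summable_geometric_of_lt_one hβ0 hβ1
  have hsum : ∀ f : ℕ → ℝ, (∀ t, |f t| ≤ C) → Summable fun t => β ^ t * f t := fun f hf =>
    Summable.of_norm_bounded (hgeo.mul_right C) fun t => by
      rw [norm_mul, Real.norm_of_nonneg (pow_nonneg hβ0 t)]
      exact mul_le_mul_of_nonneg_left (hf t) (pow_nonneg hβ0 t)
  have hsj := hsum j hj
  have hsj' : Summable fun t => β ^ (t + 1) * j (t + 1) :=
    (summable_nat_add_iff (f := fun t => β ^ t * j t) 1).2 hsj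
  have hsB := hgeo.mul_right B
  have h0 : ∑' t, β ^ t * j t = j 0 + ∑' t, β ^ (t + 1) * j (t + 1) := by
    rw [hsj.tsum_eq_zero_add]; simp
  -- The hypothesis multiplied by `β ^ t` and summed: the `j` terms telescope to `j 0` and the
  -- errors form a geometric series.
  have hle : ∑' t, (β ^ t * j t - β ^ (t + 1) * j (t + 1) - β ^ t * B) ≤ ∑' t, β ^ t * a t := by
    refine Summable.tsum_le_tsum (fun t => ?_) ((hsj.sub hsj').sub hsB) (hsum a ha)
    have := mul_le_mul_of_nonneg_left (h t) (pow_nonneg hβ0 t)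
    rw [pow_succ]
    linarith
  rw [(hsj.sub hsj').tsum_sub hsB, hsj.tsum_sub hsj', h0, tsum_mul_right,
    tsum_geometric_of_lt_one hβ0 hβ1] at hle
  rw [div_eq_inv_mul]
  linarith

end Telescoping

/-! ### Evolution of the sliding window along a trajectory. -/

section Windows

variable {X Y U : Type*}

theorem seqWindow_shift (y : ℕ → Y) (u : ℕ → U) (N : ℕ) :
    (seqWindow y u N).shift (u N) (y (N + 1))
      = seqWindow (fun i => y (1 + i)) (fun i => u (1 + i)) N := by
  have h1 : (Fin.snoc (fun i : Fin (N + 1) => y i) (y (N + 1)) : Fin (N + 2) → Y)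
      = fun i : Fin (N + 2) => y i := by
    funext i
    refine Fin.lastCases ?_ (fun j => ?_) i <;> simp
  have h2 : (Fin.snoc (fun i : Fin N => u i) (u N) : Fin (N + 1) → U) = fun i : Fin (N + 1) => u i := by
    funext i
    refine Fin.lastCases ?_ (fun j => ?_) i <;> simp
  rw [Window.shift, seqWindow, seqWindow, h1, h2]
  simp only [Fin.val_succ, Nat.add_comm 1]

theorem windowAt_eq_seqWindow (γ : Policy Y U) (N t : ℕ) (ω : ℕ → X × Y) :
    windowAt γ N t ω
      = seqWindow (fun i => obsAt (t + i) ω) (fun i => actionAt γ (t + i) ω) N := rfl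

theorem windowAt_succ (γ : Policy Y U) (N t : ℕ) (ω : ℕ → X × Y) :
    windowAt γ N (t + 1) ω
      = (windowAt γ N t ω).shift (actionAt γ (t + N) ω) (obsAt (t + N + 1) ω) := by
  rw [windowAt_eq_seqWindow, windowAt_eq_seqWindow]
  have := seqWindow_shift (fun i => obsAt (t + i) ω) (fun i => actionAt γ (t + i) ω) N
  simp only [← Nat.add_assoc] at this ⊢
  exact this.symm

theorem actionAt_of_mem_obsEvent {γ : Policy Y U} {y : ℕ → Y} {n : ℕ} {ω : ℕ → X × Y}
    (hω : ω ∈ obsEvent X fun i : Fin (n + 1) => y i) {i : ℕ} (hi : i ≤ n) :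
    actionAt γ i ω = actSeq γ y i :=
  actSeq_congr γ (y := fun i => obsAt i ω) fun j hj => hω ⟨j, by omega⟩

theorem windowAt_of_mem_obsEvent {γ : Policy Y U} {y : ℕ → Y} {N t : ℕ} {ω : ℕ → X × Y}
    (hω : ω ∈ obsEvent X fun i : Fin (t + N + 1) => y i) :
    windowAt γ N t ω
      = seqWindow (fun i => y (t + i)) (fun i => actSeq γ y (t + i)) N := by
  refine Prod.ext (funext fun i => ?_) (funext fun i => ?_)
  · exact hω ⟨t + i, by have := i.2; omega⟩
  · exact actionAt_of_mem_obsEvent hω (by have := i.2; omega)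

/-- From time `N` on, a steered window policy acts on the current window. -/
theorem actionAt_steer_windowPolicy [Nonempty U] {N : ℕ} (u : Fin N → U) (φ : Window Y U N → U)
    (t : ℕ) (ω : ℕ → X × Y) :
    actionAt (steer u (windowPolicy φ)) (t + N) ω
      = φ (windowAt (steer u (windowPolicy φ)) N t ω) := by
  change actSeq _ (fun i => obsAt i ω) (t + N) = _
  rw [actSeq_eq]
  simp only [steer, windowPolicy]
  rw [dif_neg (by omega), dif_pos (by omega)]
  simp only [Nat.add_sub_cancel]
  rfl

end Windows

/-! ### From single observation histories to events they determine. -/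

section Histories

variable {X Y U : Type*} [MeasurableSpace X]
  [Fintype Y] [MeasurableSpace Y] [MeasurableSingletonClass Y]

/-- A bound on the integral over every observation history of a given length extends to the
events which are determined by such histories. -/
theorem abs_setIntegral_le_of_forall_obsEvent {P : Measure (ℕ → X × Y)} [IsFiniteMeasure P]
    {f : (ℕ → X × Y) → ℝ} (hf : Integrable f P) {B : ℝ} {k : ℕ} (S : Set (Fin k → Y))
    (h : ∀ v : Fin k → Y, |∫ ω in obsEvent X v, f ω ∂P| ≤ B * P.real (obsEvent X v)) :
    |∫ ω in {ω | (fun i : Fin k => obsAt i.1 ω) ∈ S}, f ω ∂P|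
      ≤ B * P.real {ω | (fun i : Fin k => obsAt i.1 ω) ∈ S} := by
  classical
  have hE : {ω : ℕ → X × Y | (fun i : Fin k => obsAt i.1 ω) ∈ S}
      = ⋃ v ∈ S.toFinset, obsEvent X v := by
    ext ω
    simp only [Set.mem_ofPred_eq, Set.mem_iUnion, Set.mem_toFinset, obsEvent, exists_prop]
    constructor
    · exact fun hω => ⟨_, hω, fun i => rfl⟩
    · rintro ⟨v, hv, hω⟩
      rwa [funext hω]
  have hd : (S.toFinset : Set (Fin k → Y)).PairwiseDisjoint (obsEvent X) := by
    intro v _ v' _ hvv'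
    refine Set.disjoint_left.2 fun ω (h1 : ∀ i : Fin k, _) (h2 : ∀ i : Fin k, _) => hvv' ?_
    funext i
    rw [← h1 i, ← h2 i]
  rw [hE, integral_biUnion_finset _ (fun v _ => measurableSet_obsEvent v) hd
    (fun v _ => hf.integrableOn),
    measureReal_biUnion_finset hd (fun v _ => measurableSet_obsEvent v), Finset.mul_sum]
  exact (Finset.abs_sum_le_sum_abs _ _).trans (Finset.sum_le_sum fun v _ => h v)

end Histories

/-! ### One step of the process and the Bellman operator as integrals over the hidden state. -/

section OneStep

variable {X Y U : Type*} [MeasurableSpace X]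
  [Fintype Y] [MeasurableSpace Y] [MeasurableSingletonClass Y]
  [Fintype U] [MeasurableSpace U] [MeasurableSingletonClass U]
  (T : Kernel (X × U) X) [IsMarkovKernel T] (Q : Kernel X Y) [IsMarkovKernel Q]

/-- The conditional mean of `f Yₙ₊₁`, given the state and the action at time `n`. -/
noncomputable def nextMean (f : Y → ℝ) (v : U) (x : X) : ℝ :=
  ∑ y, ((Q ∘ₖ T.sectL v) x).real {y} * f y

theorem measurable_nextMean (f : Y → ℝ) (v : U) : Measurable (nextMean T Q f v) := by
  unfold nextMean
  refine Finset.measurable_sum _ fun y _ => Measurable.mul_const ?_ _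
  exact ((Q ∘ₖ T.sectL v).measurable_coe (measurableSet_singleton y)).ennreal_toReal

theorem abs_nextMean_le {f : Y → ℝ} {m : ℝ} (hf : ∀ y, |f y| ≤ m) (v : U) (x : X) :
    |nextMean T Q f v x| ≤ m := by
  refine (Finset.abs_sum_le_sum_abs _ _).trans ?_
  calc ∑ y, |((Q ∘ₖ T.sectL v) x).real {y} * f y|
      ≤ ∑ y, ((Q ∘ₖ T.sectL v) x).real {y} * m := Finset.sum_le_sum fun y _ => by
        rw [abs_mul, abs_of_nonneg measureReal_nonneg]
        exact mul_le_mul_of_nonneg_left (hf y) measureReal_nonneg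
    _ = m := by rw [← Finset.sum_mul, sum_measureReal_singleton]; simp

theorem integral_obsEvent_nextObs (γ : Policy Y U) (z : Measure X) [IsProbabilityMeasure z]
    (y : ℕ → Y) (n : ℕ) (f : Y → ℝ) :
    ∫ ω in obsEvent X (fun i : Fin (n + 1) => y i), f (obsAt (n + 1) ω) ∂pathMeasure T Q γ z
      = ∫ x, nextMean T Q f (actSeq γ y n) x ∂unnormFilter T Q y (actSeq γ y) z n := by
  set P := pathMeasure T Q γ z with hP
  set F := unnormFilter T Q y (actSeq γ y) z n with hF
  have hprob : ∀ y' : Y, ((P.restrict (obsEvent X fun i : Fin (n + 1) => y i)).map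
      (obsAt (n + 1))).real {y'}
      = ∫ x, ((Q ∘ₖ T.sectL (actSeq γ y n)) x).real {y'} ∂F := by
    intro y'
    -- Appending `y'` makes the joint event a history one step longer, whose probability is the mass
    -- of the filter at `n + 1`; earlier actions are unaffected.
    set y₁ : ℕ → Y := Function.update y (n + 1) y' with hy₁
    have hlt : ∀ i ≤ n, y₁ i = y i := fun i hi => Function.update_of_ne (by omega) _ _
    have hact : ∀ i ≤ n, actSeq γ y₁ i = actSeq γ y i := fun i hi =>
      actSeq_congr γ fun j hj => hlt j (hj.trans hi)
    have hset : obsAt (n + 1) ⁻¹' {y'} ∩ obsEvent X (fun i : Fin (n + 1) => y i)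
        = obsEvent X fun i : Fin (n + 1 + 1) => y₁ i := by
      rw [obsEvent_succ y₁ (n + 1), Set.inter_comm]
      have h1 : (fun i : Fin (n + 1) => y i) = fun i : Fin (n + 1) => y₁ i :=
        funext fun i => (hlt i (Nat.lt_succ_iff.1 i.2)).symm
      rw [h1]
      congr 1
      ext ω
      simp [hy₁, obsAt]
    rw [measureReal_def, Measure.map_apply (by fun_prop) (measurableSet_singleton _),
      Measure.restrict_apply (measurable_obsAt _ (measurableSet_singleton _)), hset, hP,
      pathMeasure_obsEvent, unnormFilter_univ_succ, hact n le_rfl,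
      unnormFilter_congr T Q z hlt fun i hi => hact i hi.le, ← hF, ← integral_toReal]
    · rw [hy₁, Function.update_self]; rfl
    · exact ((Q ∘ₖ T.sectL _).measurable_coe (measurableSet_singleton _)).aemeasurable
    · exact ae_of_all _ fun x => measure_lt_top _ _
  have hint : ∀ y' : Y, Integrable
      (fun x => ((Q ∘ₖ T.sectL (actSeq γ y n)) x).real {y'} * f y') F := fun y' =>
    (Integrable.of_bound ((Q ∘ₖ T.sectL _).measurable_coe
      (measurableSet_singleton y')).ennreal_toReal.aestronglyMeasurable 1
      (ae_of_all _ fun x => by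
        rw [Real.norm_of_nonneg ENNReal.toReal_nonneg]; exact measureReal_le_one)).mul_const _
  rw [← integral_map (φ := obsAt (n + 1)) (by fun_prop)
    (Measurable.of_discrete (f := f)).aestronglyMeasurable,
    integral_fintype (Integrable.of_finite)]
  simp only [nextMean, smul_eq_mul, hprob]
  rw [integral_finsetSum _ fun y' _ => hint y']
  simp only [integral_mul_const]

theorem integral_obsEvent_state (γ : Policy Y U) (z : Measure X) [IsProbabilityMeasure z]
    (y : ℕ → Y) (n : ℕ) {f : X → ℝ} (hf : Measurable f) :
    ∫ ω in obsEvent X (fun i : Fin (n + 1) => y i), f (stateAt n ω) ∂pathMeasure T Q γ z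
      = ∫ x, f x ∂unnormFilter T Q y (actSeq γ y) z n := by
  rw [← (pathMeasure_restrict_map T Q γ z y n).2,
    integral_map (by fun_prop) hf.aestronglyMeasurable]

/-- The discounted cost-to-go of the approximate model as a function of the hidden state. -/
noncomputable def stepCost (c : X × U → ℝ) (β : ℝ) {N : ℕ} (J : Window Y U N → ℝ)
    (w : Window Y U N) (v : U) (x : X) : ℝ :=
  c (x, v) + β * nextMean T Q (fun y => J (w.shift v y)) v x

variable {c : X × U → ℝ} (hc : Measurable c)
include hc

theorem measurable_stepCost (β : ℝ) {N : ℕ} (J : Window Y U N → ℝ) (w : Window Y U N) (v : U) :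
    Measurable (stepCost T Q c β J w v) :=
  (hc.comp (measurable_id.prodMk measurable_const)).add
    ((measurable_nextMean T Q _ v).const_mul β)

omit hc in
theorem abs_stepCost_le {M m β : ℝ} (hM : ∀ p, |c p| ≤ M) (hβ : 0 ≤ β) {N : ℕ}
    {J : Window Y U N → ℝ} (hJ : ∀ w, |J w| ≤ m) (w : Window Y U N) (v : U) (x : X) :
    |stepCost T Q c β J w v x| ≤ M + β * m := by
  refine (abs_add_le _ _).trans (add_le_add (hM _) ?_)
  rw [abs_mul, abs_of_nonneg hβ]
  exact mul_le_mul_of_nonneg_left (abs_nextMean_le T Q (fun y => hJ _) v x) hβ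

variable [Nonempty U]

/-- The integrand does not involve `zs`, so replacing the true conditional law by the approximate
one only changes the posterior, an error controlled by total variation. -/
theorem approxBellman_eq_integral {M β : ℝ} (hM : ∀ p, |c p| ≤ M) (zs : Measure X)
    [IsProbabilityMeasure zs] {N : ℕ} (J : Window Y U N → ℝ) (w : Window Y U N) (v : U) :
    approxBellman T Q c β zs J w v = ∫ x, stepCost T Q c β J w v x ∂posterior T Q zs w := by
  classical
  have := nonempty_obs_of_measure Q zs
  obtain ⟨y, u₀, rfl⟩ := seqWindow_surjective w
  -- Storing `v` at position `N` turns the window's actions followed by `v` into a prefix of one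
  -- sequence.
  obtain ⟨u, hu, huN⟩ : ∃ u : ℕ → U, (∀ i < N, u i = u₀ i) ∧ u N = v :=
    ⟨Function.update u₀ N v, fun i hi => Function.update_of_ne hi.ne _ _, Function.update_self ..⟩
  have hw : seqWindow y u₀ N = seqWindow y u N :=
    Prod.ext rfl (funext fun i => (hu i i.2).symm)
  rw [hw, ← huN]
  have hsnoc : (Fin.snoc (seqWindow y u N).2 (u N) : Fin (N + 1) → U)
      = fun i : Fin (N + 1) => u i := by
    funext i
    refine Fin.lastCases ?_ (fun j => ?_) i <;> simp [seqWindow]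
  set w := seqWindow y u N with hwdef
  set γ : Policy Y U := steer (fun i : Fin (N + 1) => u i) (defaultPolicy Y U) with hγ
  have hact : ∀ i < N + 1, actSeq γ y i = u i := fun i hi => actSeq_steer_of_lt u _ y hi
  set P := pathMeasure T Q γ zs with hP
  set F := unnormFilter T Q y u zs N with hF
  have hF' : unnormFilter T Q y (actSeq γ y) zs N = F :=
    unnormFilter_congr T Q zs (fun _ _ => rfl) fun i hi => hact i (by omega)
  have hpost : posterior T Q zs w = (F Set.univ)⁻¹ • F := posterior_seqWindow T Q zs y u N
  have hcond : P[|obsEvent X w.1]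
      = (F Set.univ)⁻¹ • P.restrict (obsEvent X fun i : Fin (N + 1) => y i) := by
    rw [ProbabilityTheory.cond]
    congr 2
    rw [← hF', ← pathMeasure_obsEvent]
    rfl
  have hsum : ∑ w' : Window Y U N, J w' * approxTrans T Q zs w (u N) w'
      = ∫ x, nextMean T Q (fun y => J (w.shift (u N) y)) (u N) x ∂posterior T Q zs w := by
    rw [hpost, integral_smul_measure, ← hF', ← hact N (Nat.lt_succ_self N),
      ← integral_obsEvent_nextObs, ← hP, hact N (Nat.lt_succ_self N), hF',
      ← integral_smul_measure, ← hcond]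
    have hm : Measurable fun ω : ℕ → X × Y => w.shift (u N) (obsAt (N + 1) ω) :=
      (Measurable.of_discrete (f := fun y => w.shift (u N) y)).comp (by fun_prop)
    rw [← integral_map (f := J) hm.aemeasurable
      (Measurable.of_discrete (f := J)).aestronglyMeasurable,
      integral_fintype (Integrable.of_finite)]
    refine Finset.sum_congr rfl fun w' _ => ?_
    rw [smul_eq_mul, mul_comm, measureReal_def, Measure.map_apply hm (measurableSet_singleton w'),
      approxTrans, hsnoc]
    rfl
  have hsum' : approxBellman T Q c β zs J w (u N)
      = approxCost T Q c zs w (u N)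
        + β * ∑ w' : Window Y U N, J w' * approxTrans T Q zs w (u N) w' := by
    rw [approxBellman]
  have hfin : IsFiniteMeasure (posterior T Q zs w) := by
    rw [posterior]; infer_instance
  obtain ⟨m, hm⟩ := (Set.finite_range fun w => |J w|).bddAbove
  rw [hsum', hsum, approxCost]
  unfold stepCost
  rw [integral_add, integral_const_mul]
  · exact Integrable.of_bound
      (hc.comp (measurable_id.prodMk measurable_const)).aestronglyMeasurable M
      (ae_of_all _ fun x => hM _)
  · exact Integrable.const_mul (Integrable.of_bound
      (measurable_nextMean T Q _ _).aestronglyMeasurable m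
      (ae_of_all _ fun x => abs_nextMean_le T Q (fun y => hm ⟨_, rfl⟩) _ x)) β

end OneStep

/-! ### Performance of the finite window policy. -/

section Performance

variable {X Y U : Type*} [MeasurableSpace X]
  [Fintype Y] [MeasurableSpace Y] [MeasurableSingletonClass Y]
  [Fintype U] [MeasurableSpace U] [MeasurableSingletonClass U] [Nonempty U]
  {T : Kernel (X × U) X} [IsMarkovKernel T] {Q : Kernel X Y} [IsMarkovKernel Q]

@[fun_prop]
theorem measurable_actionAt (γ : Policy Y U) (n : ℕ) :
    Measurable (actionAt γ n : (ℕ → X × Y) → U) :=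
  (Measurable.of_discrete (f := γ.act n)).comp (by fun_prop)

@[fun_prop]
theorem measurable_windowAt (γ : Policy Y U) (N t : ℕ) :
    Measurable (windowAt γ N t : (ℕ → X × Y) → Window Y U N) := by
  unfold windowAt; fun_prop

variable {ε : ℝ} (hε : 0 < ε) (hQ : ∀ (x : X) (y : Y), ε ≤ (Q x).real {y})
  {c : X × U → ℝ} (hc : Measurable c) {M : ℝ} (hM : ∀ p, |c p| ≤ M)
  {β : ℝ} (hβ0 : 0 ≤ β) (hβ1 : β < 1) {zs : Measure X} [IsProbabilityMeasure zs]
  {N : ℕ}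
include hε hQ hc hM hβ0 hβ1

/-- The value function of the approximate model is bounded by `‖c‖ / (1 - β)`. -/
theorem abs_value_le {J : Window Y U N → ℝ} {φ : Window Y U N → U}
    (hJ : ∀ w, approxBellman T Q c β zs J w (φ w) = J w) (w : Window Y U N) :
    |J w| ≤ M / (1 - β) := by
  have : Nonempty (Window Y U N) := ⟨w⟩
  obtain ⟨w₀, hw₀⟩ := Finite.exists_max fun w => |J w|
  have := isProbabilityMeasure_posterior (T := T) hε hQ zs w₀
  -- The fixed-point equation at a window maximising `|J|`, with that maximum used to bound `J` at
  -- the next window.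
  have h1 : |J w₀| ≤ M + β * |J w₀| := by
    nth_rewrite 1 [← hJ w₀]
    rw [approxBellman_eq_integral T Q hc hM, ← Real.norm_eq_abs]
    refine (norm_integral_le_of_norm_le_const
      (ae_of_all _ fun x => abs_stepCost_le T Q hM hβ0 hw₀ w₀ _ x)).trans (by simp)
  refine (hw₀ w).trans ?_
  rw [le_div_iff₀ (by linarith)]
  linarith

variable {L : ℝ} (hL : ∀ (z : Measure X) [IsProbabilityMeasure z] (w : Window Y U N),
  tvDist (posterior T Q z w) (posterior T Q zs w) ≤ L)
include hL

/-- Along each observation history, the approximate model predicts the discounted cost-to-go up to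
the filter stability error. -/
theorem abs_setIntegral_obsEvent_le {J : Window Y U N → ℝ} (hJ : ∀ w, |J w| ≤ M / (1 - β))
    (z : Measure X) [IsProbabilityMeasure z] (γ : Policy Y U) (t : ℕ) (y : ℕ → Y) :
    |∫ ω in obsEvent X (fun i : Fin (t + N + 1) => y i),
        (c (stateAt (t + N) ω, actionAt γ (t + N) ω) + β * J (windowAt γ N (t + 1) ω)
          - approxBellman T Q c β zs J (windowAt γ N t ω) (actionAt γ (t + N) ω))
        ∂pathMeasure T Q γ z|
      ≤ M / (1 - β) * L
        * (pathMeasure T Q γ z).real (obsEvent X fun i : Fin (t + N + 1) => y i) := by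
  set P := pathMeasure T Q γ z with hP
  set E := obsEvent X fun i : Fin (t + N + 1) => y i with hE
  set u := actSeq γ y with hu
  set F := unnormFilter T Q y u z (t + N) with hF
  set w := seqWindow (fun i => y (t + i)) (fun i => u (t + i)) N with hw
  have hβ' : 0 < 1 - β := by linarith
  have hsc : ∀ x, |stepCost T Q c β J w (u (t + N)) x| ≤ M / (1 - β) := fun x => by
    have h1 := abs_stepCost_le T Q hM hβ0 hJ w (u (t + N)) x
    have h2 : M + β * (M / (1 - β)) = M / (1 - β) := by field_simp; ring
    rwa [h2] at h1
  have hscm := measurable_stepCost T Q hc β J w (u (t + N))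
  have hF0 : F ≠ 0 := unnormFilter_ne_zero T hε hQ y u (IsProbabilityMeasure.ne_zero z) _
  have hPE : P.real E = F.real Set.univ := by
    rw [measureReal_def, hP, hE, pathMeasure_obsEvent]; rfl
  -- `ν` is the predictor at time `t` on this history. Restarting there, the true filter at time `t
  -- + N` is the posterior of the last window started from `ν`, which is what `hL` compares with
  -- `zs`.
  set ν := (prior T Q y u z t Set.univ)⁻¹ • prior T Q y u z t with hν
  have hp0 := prior_ne_zero T hε hQ y u (IsProbabilityMeasure.ne_zero z) t
  have hνp : IsProbabilityMeasure ν := isProbabilityMeasure_normalize hp0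
  have hcne : (prior T Q y u z t Set.univ)⁻¹ ≠ 0 := ENNReal.inv_ne_zero.2 (measure_ne_top _ _)
  have hcnt : (prior T Q y u z t Set.univ)⁻¹ ≠ ∞ := ENNReal.inv_ne_top.2 (by simpa using hp0)
  have hpost : posterior T Q ν w = (F Set.univ)⁻¹ • F := by
    rw [hw, posterior_seqWindow, hν, unnormFilter_smul, ← unnormFilter_add, ← hF,
      Measure.smul_apply, smul_eq_mul, ENNReal.mul_inv (Or.inl hcne) (Or.inl hcnt), smul_smul,
      mul_right_comm, ENNReal.inv_mul_cancel hcne hcnt, one_mul]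
  have hFreal : 0 < F.real Set.univ := by
    rw [measureReal_def]
    exact ENNReal.toReal_pos (by simpa using hF0) (measure_ne_top _ _)
  have hintF : ∫ x, stepCost T Q c β J w (u (t + N)) x ∂F
      = F.real Set.univ * ∫ x, stepCost T Q c β J w (u (t + N)) x ∂posterior T Q ν w := by
    rw [hpost, integral_smul_measure, smul_eq_mul, ENNReal.toReal_inv, ← measureReal_def,
      mul_inv_cancel_left₀ hFreal.ne']
  have hstep : ∫ ω in E, (c (stateAt (t + N) ω, actionAt γ (t + N) ω)
      + β * J (windowAt γ N (t + 1) ω)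
      - approxBellman T Q c β zs J (windowAt γ N t ω) (actionAt γ (t + N) ω)) ∂P
      = F.real Set.univ * (∫ x, stepCost T Q c β J w (u (t + N)) x ∂posterior T Q ν w
        - ∫ x, stepCost T Q c β J w (u (t + N)) x ∂posterior T Q zs w) := by
    -- On `E` the current window and action are constants; only the state and the next observation
    -- remain random.
    have hcongr : ∫ ω in E, (c (stateAt (t + N) ω, actionAt γ (t + N) ω)
        + β * J (windowAt γ N (t + 1) ω)
        - approxBellman T Q c β zs J (windowAt γ N t ω) (actionAt γ (t + N) ω)) ∂P
        = ∫ ω in E, (c (stateAt (t + N) ω, u (t + N))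
          + β * J (w.shift (u (t + N)) (obsAt (t + N + 1) ω))
          - approxBellman T Q c β zs J w (u (t + N))) ∂P := by
      refine setIntegral_congr_fun (measurableSet_obsEvent _) fun ω hω => ?_
      simp only [windowAt_succ, windowAt_of_mem_obsEvent hω, actionAt_of_mem_obsEvent hω le_rfl]
      rfl
    have i1 : Integrable (fun ω => c (stateAt (t + N) ω, u (t + N))) (P.restrict E) :=
      Integrable.of_bound (hc.comp (by fun_prop)).aestronglyMeasurable M
        (ae_of_all _ fun ω => hM _)
    have i2 : Integrable (fun ω => β * J (w.shift (u (t + N)) (obsAt (t + N + 1) ω)))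
        (P.restrict E) :=
      (Integrable.of_bound ((Measurable.of_discrete
        (f := fun y => J (w.shift (u (t + N)) y))).comp (by fun_prop)).aestronglyMeasurable
        (M / (1 - β)) (ae_of_all _ fun ω => hJ _)).const_mul β
    have j1 : Integrable (fun x => c (x, u (t + N))) F :=
      Integrable.of_bound (hc.comp (by fun_prop)).aestronglyMeasurable M
        (ae_of_all _ fun ω => hM _)
    have j2 : Integrable (fun x => β * nextMean T Q
        (fun y => J (w.shift (u (t + N)) y)) (u (t + N)) x) F :=
      (Integrable.of_bound (measurable_nextMean T Q _ _).aestronglyMeasurable (M / (1 - β))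
        (ae_of_all _ fun x => abs_nextMean_le T Q (fun y => hJ _) _ x)).const_mul β
    have i12 : Integrable (fun ω => c (stateAt (t + N) ω, u (t + N))
        + β * J (w.shift (u (t + N)) (obsAt (t + N + 1) ω))) (P.restrict E) := i1.add i2
    rw [hcongr, integral_sub i12 (integrable_const _), integral_add i1 i2,
      integral_const_mul, integral_const, hP, hE,
      integral_obsEvent_state T Q γ z y (t + N) (f := fun x => c (x, u (t + N)))
        (hc.comp (by fun_prop)),
      integral_obsEvent_nextObs T Q γ z y (t + N) fun y => J (w.shift (u (t + N)) y),
      ← hu, ← hF, ← integral_const_mul, ← integral_add j1 j2, ← hP, ← hE,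
      measureReal_restrict_apply .univ, Set.univ_inter, hPE, smul_eq_mul, mul_sub, ← hintF,
      approxBellman_eq_integral T Q hc hM]
    rfl
  have := isProbabilityMeasure_posterior (T := T) hε hQ ν w
  have := isProbabilityMeasure_posterior (T := T) hε hQ zs w
  rw [hstep, abs_mul, abs_of_pos hFreal, hPE, mul_comm]
  refine mul_le_mul_of_nonneg_right ?_ hFreal.le
  refine (abs_integral_sub_le_tvDist _ _ hscm hsc).trans ?_
  refine mul_le_mul_of_nonneg_left (hL ν w) ?_
  obtain ⟨x⟩ := nonempty_of_measure_ne_zero hF0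
  exact (abs_nonneg _).trans (hsc x)

/-- The conditional version of `abs_setIntegral_obsEvent_le`, given the initial window. -/
theorem abs_integral_cond_le {J : Window Y U N → ℝ} (hJ : ∀ w, |J w| ≤ M / (1 - β))
    (z : Measure X) [IsProbabilityMeasure z] (γ : Policy Y U) (t : ℕ) (y₀ : Fin (N + 1) → Y) :
    |∫ ω, (c (stateAt (t + N) ω, actionAt γ (t + N) ω) + β * J (windowAt γ N (t + 1) ω)
          - approxBellman T Q c β zs J (windowAt γ N t ω) (actionAt γ (t + N) ω))
        ∂(pathMeasure T Q γ z)[|obsEvent X y₀]| ≤ M / (1 - β) * L := by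
  have := nonempty_obs_of_measure Q z
  set P := pathMeasure T Q γ z with hP
  set f : (ℕ → X × Y) → ℝ := fun ω =>
    c (stateAt (t + N) ω, actionAt γ (t + N) ω) + β * J (windowAt γ N (t + 1) ω)
      - approxBellman T Q c β zs J (windowAt γ N t ω) (actionAt γ (t + N) ω) with hf
  have hfi : Integrable f P := by
    refine Integrable.sub (Integrable.add ?_ (Integrable.const_mul ?_ β)) ?_
    · exact Integrable.of_bound (hc.comp (by fun_prop)).aestronglyMeasurable M
        (ae_of_all _ fun ω => hM _)
    · exact Integrable.of_bound ((Measurable.of_discrete (f := J)).comp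
        (by fun_prop)).aestronglyMeasurable (M / (1 - β)) (ae_of_all _ fun ω => hJ _)
    · have hm : Measurable fun p : Window Y U N × U => approxBellman T Q c β zs J p.1 p.2 :=
        Measurable.of_discrete
      obtain ⟨b, hb⟩ := (Set.finite_range fun p : Window Y U N × U =>
        |approxBellman T Q c β zs J p.1 p.2|).bddAbove
      exact Integrable.of_bound (hm.comp (by fun_prop :
        Measurable fun ω => (windowAt γ N t ω, actionAt γ (t + N) ω))).aestronglyMeasurable b
        (ae_of_all _ fun ω => hb ⟨(windowAt γ N t ω, actionAt γ (t + N) ω), rfl⟩)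
  -- The initial window event is a finite disjoint union of histories up to time `t + N`, so the
  -- bound per history adds up.
  set S : Set (Fin (t + N + 1) → Y) :=
    {v | ∀ i : Fin (N + 1), v ⟨i, by have := i.2; omega⟩ = y₀ i} with hS
  have hE : obsEvent X y₀ = {ω | (fun i : Fin (t + N + 1) => obsAt i.1 ω) ∈ S} := rfl
  have hbound : |∫ ω in obsEvent X y₀, f ω ∂P| ≤ M / (1 - β) * L * P.real (obsEvent X y₀) := by
    rw [hE]
    refine abs_setIntegral_le_of_forall_obsEvent hfi S fun v => ?_
    obtain ⟨y, rfl⟩ := exists_seq_extension v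
    exact abs_setIntegral_obsEvent_le hε hQ hc hM hβ0 hβ1 hL hJ z γ t _
  have hpos : 0 < P.real (obsEvent X y₀) := by
    obtain ⟨y, rfl⟩ := exists_seq_extension y₀
    rw [measureReal_def, hP, pathMeasure_obsEvent]
    refine ENNReal.toReal_pos ?_ (measure_ne_top _ _)
    simpa using unnormFilter_ne_zero T hε hQ _ _ (IsProbabilityMeasure.ne_zero z) N
  rw [ProbabilityTheory.cond, integral_smul_measure, smul_eq_mul, abs_mul, ENNReal.toReal_inv,
    ← measureReal_def, abs_of_pos (inv_pos.2 hpos), inv_mul_le_iff₀ hpos, mul_comm (P.real _)]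
  exact hbound

omit hc hM hβ0 hβ1 hL in
theorem isProbabilityMeasure_cond_obsEvent (z : Measure X) [IsProbabilityMeasure z]
    (γ : Policy Y U) (y₀ : Fin (N + 1) → Y) :
    IsProbabilityMeasure ((pathMeasure T Q γ z)[|obsEvent X y₀]) := by
  have := nonempty_obs_of_measure Q z
  obtain ⟨y, rfl⟩ := exists_seq_extension y₀
  apply cond_isProbabilityMeasure
  rw [pathMeasure_obsEvent]
  simpa using unnormFilter_ne_zero T hε hQ _ _ (IsProbabilityMeasure.ne_zero z) N

omit hL in
theorem costFrom_eq_tsum (z : Measure X) [IsProbabilityMeasure z] (w : Window Y U N)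
    (γ : Policy Y U) :
    costFrom T Q c β z w γ = ∑' t : ℕ, β ^ t *
      ∫ ω, c (stateAt (t + N) ω, actionAt (steer w.2 γ) (t + N) ω)
        ∂(pathMeasure T Q (steer w.2 γ) z)[|obsEvent X w.1] := by
  have := isProbabilityMeasure_cond_obsEvent (T := T) (N := N) hε hQ z (steer w.2 γ) w.1
  rw [costFrom, ← integral_tsum_of_summable_integral_norm]
  · refine tsum_congr fun t => ?_
    rw [integral_const_mul, Nat.add_comm N t]
  · exact fun t => (Integrable.of_bound (hc.comp (by fun_prop)).aestronglyMeasurable M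
      (ae_of_all _ fun ω => hM _)).const_mul _
  · refine Summable.of_nonneg_of_le (fun t => integral_nonneg fun _ => norm_nonneg _)
      (fun t => ?_) ((summable_geometric_of_lt_one hβ0 hβ1).mul_right M)
    refine (Real.le_norm_self _).trans ((norm_integral_le_of_norm_le_const (C := β ^ t * M)
      (ae_of_all _ fun ω => ?_)).trans (by simp))
    rw [norm_norm, norm_mul, Real.norm_of_nonneg (pow_nonneg hβ0 t)]
    exact mul_le_mul_of_nonneg_left (hM _) (pow_nonneg hβ0 t)

/-- A verification argument. Let `a`, `j`, `b` be the conditional means of cost, value and Bellman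
expression at each step. Then `a + β j⁺` is within the stability error of `b`, with `b ≥ j` for any
policy and `b = j` for the window policy. -/
theorem costFrom_bounds {J : Window Y U N → ℝ} {φ : Window Y U N → U}
    (hJ : ∀ w u, J w ≤ approxBellman T Q c β zs J w u)
    (hφ : ∀ w, approxBellman T Q c β zs J w (φ w) = J w)
    (z : Measure X) [IsProbabilityMeasure z] (w : Window Y U N) :
    (∀ γ, J w - M / (1 - β) * L / (1 - β) ≤ costFrom T Q c β z w γ) ∧
      costFrom T Q c β z w (windowPolicy φ) ≤ J w + M / (1 - β) * L / (1 - β) := by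
  have hJb := abs_value_le (T := T) hε hQ hc hM hβ0 hβ1 (zs := zs) hφ
  have hβ' : 0 < 1 - β := by linarith
  have hM0 : 0 ≤ M := by
    obtain ⟨x⟩ := nonempty_of_measure_ne_zero (IsProbabilityMeasure.ne_zero z)
    exact (abs_nonneg _).trans (hM (x, Classical.arbitrary U))
  have hMle : M ≤ M / (1 - β) := by
    rw [le_div_iff₀ hβ']
    nlinarith
  have hprob := isProbabilityMeasure_cond_obsEvent (T := T) (N := N) hε hQ z
  set a : Policy Y U → ℕ → ℝ := fun γ t =>
    ∫ ω, c (stateAt (t + N) ω, actionAt (steer w.2 γ) (t + N) ω)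
      ∂(pathMeasure T Q (steer w.2 γ) z)[|obsEvent X w.1] with ha
  set j : Policy Y U → ℕ → ℝ := fun γ t =>
    ∫ ω, J (windowAt (steer w.2 γ) N t ω)
      ∂(pathMeasure T Q (steer w.2 γ) z)[|obsEvent X w.1] with hj
  set b : Policy Y U → ℕ → ℝ := fun γ t =>
    ∫ ω, approxBellman T Q c β zs J (windowAt (steer w.2 γ) N t ω)
        (actionAt (steer w.2 γ) (t + N) ω)
      ∂(pathMeasure T Q (steer w.2 γ) z)[|obsEvent X w.1] with hb
  have hab : ∀ γ t, |a γ t| ≤ M / (1 - β) := fun γ t => by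
    have := hprob (steer w.2 γ) w.1
    rw [← Real.norm_eq_abs]
    exact (norm_integral_le_of_norm_le_const (ae_of_all _ fun ω => (hM _).trans hMle)).trans
      (by simp)
  have hjb : ∀ γ t, |j γ t| ≤ M / (1 - β) := fun γ t => by
    have := hprob (steer w.2 γ) w.1
    rw [← Real.norm_eq_abs]
    exact (norm_integral_le_of_norm_le_const (ae_of_all _ fun ω => hJb _)).trans (by simp)
  have iJ : ∀ γ t, Integrable (fun ω => J (windowAt (steer w.2 γ) N t ω))
      ((pathMeasure T Q (steer w.2 γ) z)[|obsEvent X w.1]) := fun γ t =>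
    Integrable.of_bound ((Measurable.of_discrete (f := J)).comp
      (by fun_prop)).aestronglyMeasurable (M / (1 - β)) (ae_of_all _ fun ω => hJb _)
  have iB : ∀ γ t, Integrable (fun ω => approxBellman T Q c β zs J
      (windowAt (steer w.2 γ) N t ω) (actionAt (steer w.2 γ) (t + N) ω))
      ((pathMeasure T Q (steer w.2 γ) z)[|obsEvent X w.1]) := fun γ t => by
    have hm : Measurable fun p : Window Y U N × U => approxBellman T Q c β zs J p.1 p.2 :=
      Measurable.of_discrete
    obtain ⟨b, hb⟩ := (Set.finite_range fun p : Window Y U N × U =>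
      |approxBellman T Q c β zs J p.1 p.2|).bddAbove
    exact Integrable.of_bound (hm.comp (by fun_prop :
      Measurable fun ω => (windowAt (steer w.2 γ) N t ω,
        actionAt (steer w.2 γ) (t + N) ω))).aestronglyMeasurable b
      (ae_of_all _ fun ω => hb ⟨(windowAt (steer w.2 γ) N t ω,
        actionAt (steer w.2 γ) (t + N) ω), rfl⟩)
  have hstep : ∀ γ t, |a γ t + β * j γ (t + 1) - b γ t| ≤ M / (1 - β) * L := fun γ t => by
    have := hprob (steer w.2 γ) w.1
    have h := abs_integral_cond_le hε hQ hc hM hβ0 hβ1 hL hJb z (steer w.2 γ) t w.1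
    have iA : Integrable (fun ω => c (stateAt (t + N) ω, actionAt (steer w.2 γ) (t + N) ω))
        ((pathMeasure T Q (steer w.2 γ) z)[|obsEvent X w.1]) :=
      Integrable.of_bound (hc.comp (by fun_prop)).aestronglyMeasurable M
        (ae_of_all _ fun ω => hM _)
    have iAJ : Integrable (fun ω => c (stateAt (t + N) ω, actionAt (steer w.2 γ) (t + N) ω)
        + β * J (windowAt (steer w.2 γ) N (t + 1) ω))
        ((pathMeasure T Q (steer w.2 γ) z)[|obsEvent X w.1]) :=
      iA.add ((iJ γ (t + 1)).const_mul β)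
    rwa [integral_sub iAJ (iB γ t),
      integral_add iA ((iJ γ (t + 1)).const_mul β), integral_const_mul] at h
  -- Conditioning fixes the observations and steering fixes the actions, so the window at time `0`
  -- is almost surely `w`.
  have hj0 : ∀ γ, j γ 0 = J w := fun γ => by
    have := hprob (steer w.2 γ) w.1
    have hae : ∀ᵐ ω ∂(pathMeasure T Q (steer w.2 γ) z)[|obsEvent X w.1],
        J (windowAt (steer w.2 γ) N 0 ω) = J w := by
      filter_upwards [ae_cond_mem (measurableSet_obsEvent w.1)] with ω hω
      congr 1
      refine Prod.ext (funext fun i => ?_) (funext fun i => ?_)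
      · have : ∀ i : Fin (N + 1), obsAt i.1 ω = w.1 i := hω
        simpa [windowAt] using this i
      · simp only [windowAt, actionAt]
        rw [Policy.act, steer, dif_pos (by have := i.2; omega)]
        simp
    rw [hj]
    simp only
    rw [integral_congr_ae hae]
    simp
  constructor
  · intro γ
    rw [costFrom_eq_tsum hε hQ hc hM hβ0 hβ1, ← hj0 γ]
    refine discounted_lower_bound hβ0 hβ1 (hab γ) (hjb γ) fun t => ?_
    have h1 := (abs_le.1 (hstep γ t)).1
    have h2 : j γ t ≤ b γ t := integral_mono (iJ γ t) (iB γ t) fun ω => hJ _ _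
    linarith
  · set γ : Policy Y U := windowPolicy φ with hγ
    -- The upper bound is the lower bound applied to `-a` and `-j`.
    have h := discounted_lower_bound (B := M / (1 - β) * L) (C := M / (1 - β)) hβ0 hβ1
      (a := fun t => -a γ t) (j := fun t => -j γ t)
      (fun t => by rw [abs_neg]; exact hab γ t) (fun t => by rw [abs_neg]; exact hjb γ t)
      fun t => by
        have h1 := (abs_le.1 (hstep γ t)).2
        have h2 : b γ t = j γ t := integral_congr_ae (ae_of_all _ fun ω => by
          simp only [hγ]
          rw [actionAt_steer_windowPolicy, hφ])
        rw [h2] at h1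
        linarith
    rw [costFrom_eq_tsum hε hQ hc hM hβ0 hβ1, ← hj0 γ]
    simp only [mul_neg, tsum_neg] at h
    linarith

/-- Both costs lie within `M / (1 - β) * L / (1 - β)` of `J w`, whence the factor `2`. The
policy-independent lower bound also makes the infimum bounded below. -/
theorem perfGap_le {φ : Window Y U N → U} (hφ : IsOptimalWindowPolicy T Q c β zs φ)
    (z : Measure X) [IsProbabilityMeasure z] (w : Window Y U N) :
    perfGap T Q c β z φ w ≤ 2 * M / (1 - β) ^ 2 * L := by
  obtain ⟨J, hJ, hJφ⟩ := hφ
  have hJle : ∀ w u, J w ≤ approxBellman T Q c β zs J w u := fun w u => by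
    rw [hJ w]
    exact ciInf_le (Set.finite_range _).bddBelow u
  obtain ⟨h1, h2⟩ := costFrom_bounds hε hQ hc hM hβ0 hβ1 hL hJle hJφ z w
  have h3 : optCostFrom T Q c β z w ≤ costFrom T Q c β z w (windowPolicy φ) :=
    ciInf_le ⟨_, by rintro _ ⟨γ, rfl⟩; exact h1 γ⟩ _
  have : Nonempty (Policy Y U) := ⟨defaultPolicy Y U⟩
  have h4 : J w - M / (1 - β) * L / (1 - β) ≤ optCostFrom T Q c β z w := le_ciInf h1
  rw [perfGap, abs_of_nonneg (sub_nonneg.2 h3)]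
  have h5 : 2 * M / (1 - β) ^ 2 * L = 2 * (M / (1 - β) * L / (1 - β)) := by
    have : 1 - β ≠ 0 := by linarith
    field_simp
  linarith

end Performance

end FiniteWindow

/-! ### Assembly of the theorem. -/

open FiniteWindow in
theorem mainTheorem8 {X Y U : Type*} [MeasurableSpace X] [StandardBorelSpace X]
    [Fintype Y] [MeasurableSpace Y] [MeasurableSingletonClass Y]
    [Fintype U] [Nonempty U] [MeasurableSpace U] [MeasurableSingletonClass U]
    (T : Kernel (X × U) X) [IsMarkovKernel T] (Q : Kernel X Y) [IsMarkovKernel Q]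
    (c : X × U → ℝ) (hc : Measurable c) (hcb : ∃ C : ℝ, ∀ p, |c p| ≤ C)
    (β : ℝ) (hβ0 : 0 < β) (hβ1 : β < 1)
    (zs : Measure X) [IsProbabilityMeasure zs]
    (ε : ℝ) (hε : 0 < ε) (hQ : ∀ (x : X) (y : Y), ε ≤ (Q x).real {y})
    (e : U → ℝ) (hT : ∀ u : U, IsMixing (T.sectL u) (e u))
    (r K : ℝ) (hr : r = ⨆ u : U, (1 - e u ^ 2 * ε) / (1 + e u ^ 2 * ε))
    (hK : K = stabilityConst T Q zs) :
    (0 ≤ r ∧ r < 1) ∧ supHilbert T Q zs < ⊤ ∧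
    (∀ N : ℕ, 1 ≤ N → ∀ (z : Measure X) [IsProbabilityMeasure z] (t : ℕ),
      filterStability T Q z zs N t ≤ r ^ (N - 1) * K) ∧
    (∀ N : ℕ, 1 ≤ N → ∀ φ : Window Y U N → U, IsOptimalWindowPolicy T Q c β zs φ →
      ∀ (z : Measure X) [IsProbabilityMeasure z] (γ : Policy Y U),
        Integrable (fun ω => perfGap T Q c β z φ (windowAt γ N 0 ω)) (pathMeasure T Q γ z) ∧
        (∀ᵐ ω ∂(pathMeasure T Q γ z),
          ((pathMeasure T Q γ z)[fun ω => perfGap T Q c β z φ (windowAt γ N 0 ω) |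
              MeasurableSpace.comap (windowAt γ N 0) inferInstance]) ω
            ≤ 2 * (⨆ p : X × U, |c p|) / (1 - β) ^ 2 * r ^ (N - 1) * K) ∧
        ∫ ω, perfGap T Q c β z φ (windowAt γ N 0 ω) ∂(pathMeasure T Q γ z)
          ≤ 2 * (⨆ p : X × U, |c p|) / (1 - β) ^ 2 * r ^ (N - 1) * K) := by
  subst hr hK
  have hε1 : ε ≤ 1 := le_one_of_channel_bound hQ zs
  obtain ⟨hr, hr0, hr1⟩ := contractionRate_bounds hε hε1 (fun u => (hT u).1) fun u => (hT u).2.1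
  refine ⟨⟨hr0, hr1⟩, supHilbert_lt_top hε hQ hT zs, fun N hN z _ t =>
    filterStability_le hε hQ hT z zs hr0 hr hN t, fun N hN φ hφ z _ γ => ?_⟩
  have hM : ∀ p, |c p| ≤ ⨆ p : X × U, |c p| := fun p =>
    le_ciSup (f := fun p => |c p|)
      (hcb.imp fun C hC => by rintro _ ⟨p, rfl⟩; exact hC p) p
  have hgap : ∀ w, perfGap T Q c β z φ w ≤ 2 * (⨆ p : X × U, |c p|) / (1 - β) ^ 2
      * (⨆ u : U, (1 - e u ^ 2 * ε) / (1 + e u ^ 2 * ε)) ^ (N - 1) * stabilityConst T Q zs :=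
    fun w => by
      rw [mul_assoc]
      exact perfGap_le hε hQ hc hM hβ0.le hβ1
        (fun z _ w => tvDist_posterior_le hε hQ hT z zs hr0 hr hN w) hφ z w
  have hmeas : Measurable (perfGap T Q c β z φ : Window Y U N → ℝ) := Measurable.of_discrete
  have hint : Integrable (fun ω => perfGap T Q c β z φ (windowAt γ N 0 ω))
      (pathMeasure T Q γ z) :=
    Integrable.of_bound (hmeas.comp (by fun_prop)).aestronglyMeasurable _
      (ae_of_all _ fun ω => by
        have h0 : 0 ≤ perfGap T Q c β z φ (windowAt γ N 0 ω) := abs_nonneg _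
        rw [Real.norm_of_nonneg h0]
        exact hgap _)
  refine ⟨hint, ?_, ?_⟩
  -- The gap is a function of the window, so conditioning on the window leaves it unchanged and the
  -- pointwise bound applies.
  · rw [condExp_of_stronglyMeasurable (f := fun ω => perfGap T Q c β z φ (windowAt γ N 0 ω))
      (measurable_windowAt γ N 0).comap_le (hmeas.comp (comap_measurable _)).stronglyMeasurable hint]
    exact ae_of_all _ fun ω => hgap _
  · refine (integral_mono hint (integrable_const _) fun ω => hgap _).trans ?_
    simp
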